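/- Let $R\subset\mathbb{R}^3$ be a finite union of closed unit cubes with vertices in $\mathbb{Z}^3$. For $n\in\mathbb{Z}$, the $n$-th floor of $R$ is the union of those cubes of $R$ that lie in $\mathbb{R}^2\times[n,n+1]$. Suppose that $R$ is a duplex region, that is: exactly two floors of $R$ are non-empty, namely those with $n=0$ and $n=1$; both of them are connected and simply connected; and they are identical, i.e. the second is the first translated by $(0,0,1)$. A domino brick (dimer) is the union of two such cubes that share a face, and a tiling of $R$ is a set of dimers, no two of which have a cube in common, whose union is $R$. A flip takes a tiling of $R$ to another one by removing two parallel dimers that form a $2\times2\times1$ slab and placing them back in the only other possible position. A trit takes a tiling of $R$ to another one by removing three dimers, no two of them parallel, that lie inside a common $2\times2\times2$ cube, and covering the six cubes they occupied by three dimers in the only other possible way. Then for any two tilings $t_0,t_1$ of $R$ there is a finite sequence of flips and trits taking $t_0$ to $t_1$. -/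

import Mathlib

namespace DominoBrick

/-- The lattice point `c = (x, y, z)` stands for the closed unit cube `c + [0,1]³`. -/
abbrev Cell : Type := Fin 3 → ℤ

/-- The `i`-th unit vector of `ℤ³`; `i = 0, 1, 2` are the `x`, `y`, `z` axes. -/
def unit (i : Fin 3) : Cell := Pi.single i 1

/-- The closed unit cube of `ℝ³` named by `c`. -/
def cube (c : Cell) : Set (Fin 3 → ℝ) :=
  Set.Icc (fun i => (c i : ℝ)) (fun i => (c i : ℝ) + 1)

/-- The subset of `ℝ³` which is the union of the cubes in `S`. -/
def carrier (S : Finset Cell) : Set (Fin 3 → ℝ) := ⋃ c ∈ S, cube c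

/-- The `n`-th floor of a region: its cubes in the slab `ℝ² × [n, n+1]`. -/
def floor (R : Finset Cell) (n : ℤ) : Finset Cell := R.filter fun c => c 2 = n

/-- Exactly two floors, at heights `0` and `1`, are non-empty, and each of them is, as a subset
of `ℝ³`, connected and simply connected. -/
structure IsTwoStory (R : Finset Cell) : Prop where
  nonempty_iff : ∀ n : ℤ, (floor R n).Nonempty ↔ n = 0 ∨ n = 1
  connected : ∀ n : ℤ, n = 0 ∨ n = 1 → IsConnected (carrier (floor R n))
  simplyConnected : ∀ n : ℤ, n = 0 ∨ n = 1 → IsSimplyConnected (carrier (floor R n))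

/-- A two-story region whose two floors are identical. -/
structure IsDuplex (R : Finset Cell) : Prop extends IsTwoStory R where
  identical : ∀ x y : ℤ, ![x, y, 0] ∈ R ↔ ![x, y, 1] ∈ R

/-- `d` consists of two cubes that share a face orthogonal to the `i`-th axis. -/
def IsDimerAlong (i : Fin 3) (d : Finset Cell) : Prop := ∃ c : Cell, d = {c, c + unit i}

/-- A domino brick (dimer): two cubes that share a face. -/
def IsDimer (d : Finset Cell) : Prop := ∃ i, IsDimerAlong i d

/-- A tiling of `R`: a set of pairwise disjoint dimers whose union is `R`. -/
@[ext]
structure Tiling (R : Finset Cell) where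
  dimers : Finset (Finset Cell)
  isDimer : ∀ d ∈ dimers, IsDimer d
  disjoint : ∀ d ∈ dimers, ∀ e ∈ dimers, d ≠ e → Disjoint d e
  cover : dimers.biUnion id = R

/-- `t₁` arises from `t₀` by a flip: two parallel dimers of `t₀` which form the `2 × 2 × 1` slab
with corner `c` in the directions `i ≠ j` are removed and put back in the other position. -/
def IsFlip {R : Finset Cell} (t₀ t₁ : Tiling R) : Prop :=
  ∃ (c : Cell) (i j : Fin 3), i ≠ j ∧
    {{c, c + unit i}, {c + unit j, c + unit j + unit i}} ⊆ t₀.dimers ∧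
    t₁.dimers =
      (t₀.dimers \ {{c, c + unit i}, {c + unit j, c + unit j + unit i}}) ∪
        {{c, c + unit j}, {c + unit i, c + unit i + unit j}}

/-- `t₁` arises from `t₀` by a trit (positive or negative): inside some `2 × 2 × 2` cube
(with smallest corner `c`), three
dimers of `t₀`, one along each axis, are removed, and the six cubes they occupied are covered
by dimers in a different way. -/
def IsTrit {R : Finset Cell} (t₀ t₁ : Tiling R) : Prop :=
  ∃ (c : Cell) (A B : Finset (Finset Cell)),
    A ⊆ t₀.dimers ∧ A.card = 3 ∧ (∀ i, ∃ d ∈ A, IsDimerAlong i d) ∧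
    (∀ d ∈ A, ∀ p ∈ d, ∀ k, c k ≤ p k ∧ p k ≤ c k + 1) ∧
    B.biUnion id = A.biUnion id ∧ B ≠ A ∧
    t₁.dimers = (t₀.dimers \ A) ∪ B

end DominoBrick

namespace DominoBrick

/-! Moves are reversible and there is only one tiling by vertical dimers ("jewels") alone, so it
suffices to increase the number of jewels of any other tiling (`exists_more_jewels`).

Project both floors to the plane: shadow cells become vertices of the square lattice, horizontal
dimers become edges. A vertex without a jewel has exactly one edge from each floor, so apart from
jewels and doubled edges the picture is a union of disjoint cycles alternating between the floors. A
doubled edge flips into two jewels. The edges used on exactly one floor ("crossed") have even degree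
everywhere, hence bound a set of faces, recorded by a height modulo two. A minimal hole-free set of
faces with jumps along its boundary is an innermost region `Q` with no crossed edge inside
(`exists_innermost`). Pairs of integers name both vertices and faces, a face being named by its
lower left corner.

`Q` has Euler characteristic at least one, and counting quadrants produces a convex corner face that
is thin or solid (`exists_ear`). Let `d` be its convex vertex, `c` and `a` the vertices next to `d`,
and `b` the opposite one; the edges `dc` and `da` lie on different floors. If the corner is thin,
one flip doubles an edge and a second one makes jewels. If it is solid, no crossed edge meets `b`:
either `b` lies on a doubled edge, or it carries a jewel and a trit moves this jewel to `d`, cutting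
the face out of `Q`. Induction on the size of `Q` finishes (`exists_more_jewels_of_closed`).

Simple connectedness enters through `HoleFree`, by a winding number argument. It ensures that `b` is
a cell of the shadow (`Closed.mem_shadow`); otherwise a cycle could surround a hole. -/

/-- Two cells of the square lattice which share an edge. -/
def Nbr (u v : ℤ × ℤ) : Prop :=
  (v.1 = u.1 + 1 ∧ v.2 = u.2) ∨ (v.1 = u.1 - 1 ∧ v.2 = u.2) ∨
    (v.1 = u.1 ∧ v.2 = u.2 + 1) ∨ (v.1 = u.1 ∧ v.2 = u.2 - 1)

/-- No nonempty finite set of cells outside `S` is enclosed by `S`. -/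
def HoleFree (S : Finset (ℤ × ℤ)) : Prop :=
  ∀ U : Finset (ℤ × ℤ), (∀ u ∈ U, u ∉ S) →
    (∀ u ∈ U, ∀ v, Nbr u v → v ∈ U ∨ v ∈ S) → U = ∅

/-- The cell of floor `z` above the planar cell `v`. -/
def cell (v : ℤ × ℤ) (z : ℤ) : Cell := ![v.1, v.2, z]

/-! ### Simply connected regions have no holes: lifting the angle around a missing cell -/

/-- Clamping the coordinates retracts `ℝ³` onto the cube, which is therefore a quotient of a locally
path connected space. -/
theorem locallyPathConnectedSpace_cube (c : Cell) : LocallyPathConnectedSpace (cube c) := by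
  have hle : (fun i => (c i : ℝ)) ≤ fun i => (c i : ℝ) + 1 := fun i => by simp
  let f : (Fin 3 → ℝ) → cube c := fun x =>
    ⟨fun i => max (c i : ℝ) (min (x i) ((c i : ℝ) + 1)),
      ⟨fun i => le_max_left _ _, fun i => max_le (by simp) (min_le_right _ _)⟩⟩
  have hf : Continuous f := by
    refine Continuous.subtype_mk ?_ _
    fun_prop
  have hq : Topology.IsQuotientMap f := by
    refine Topology.IsQuotientMap.of_inverse continuous_subtype_val hf ?_
    rintro ⟨x, hx⟩
    apply Subtype.ext
    funext i
    have h1 := hx.1 i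
    have h2 := hx.2 i
    simp only at h1 h2
    simp [f, min_eq_left h2, max_eq_right h1]
  exact hq.locallyPathConnectedSpace

/-- Required by the lifting criterion for covering maps. The carrier is a quotient of a finite
disjoint union of compact cubes. -/
theorem locallyPathConnectedSpace_carrier (S : Finset Cell) :
    LocallyPathConnectedSpace (carrier S) := by
  have : ∀ c : S, LocallyPathConnectedSpace (cube c.1) :=
    fun c => locallyPathConnectedSpace_cube c.1
  have : ∀ c : S, CompactSpace (cube c.1) :=
    fun c => isCompact_iff_compactSpace.mp isCompact_Icc
  let f : (Σ c : S, cube c.1) → carrier S := fun x =>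
    ⟨x.2.1, Set.mem_biUnion x.1.2 x.2.2⟩
  have hf : Continuous f := by
    refine Continuous.subtype_mk ?_ _
    exact continuous_sigma fun c => continuous_subtype_val
  have hs : Function.Surjective f := by
    rintro ⟨x, hx⟩
    obtain ⟨c, hc, hxc⟩ := Set.mem_iUnion₂.mp hx
    exact ⟨⟨⟨c, hc⟩, ⟨x, hxc⟩⟩, rfl⟩
  exact (hf.isClosedMap.isQuotientMap hf hs).locallyPathConnectedSpace

theorem isClosed_cube (c : Cell) : IsClosed (cube c) := isClosed_Icc

theorem continuousOn_carrier {X : Type*} [TopologicalSpace X] (S : Finset Cell)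
    (g : (Fin 3 → ℝ) → X) (h : ∀ c ∈ S, ContinuousOn g (cube c)) : ContinuousOn g (carrier S) := by
  classical
  induction S using Finset.induction_on with
  | empty => simp [carrier]
  | insert c S hc ih =>
    have e : carrier (insert c S) = cube c ∪ carrier S := by simp [carrier]
    rw [e]
    refine (h c (by simp)).union_of_isClosed (ih fun d hd => h d (by simp [hd])) (isClosed_cube c) ?_
    exact S.finite_toSet.isClosed_biUnion fun c _ => isClosed_cube c

/-- A continuous lift to `ℝ` of a circle-valued map on a simply connected region. -/
theorem exists_lift (S : Finset Cell) (hS : IsSimplyConnected (carrier S))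
    (Φ : (Fin 3 → ℝ) → AddCircle (1 : ℝ)) (hΦ : ContinuousOn Φ (carrier S)) :
    ∃ F : (Fin 3 → ℝ) → ℝ, ContinuousOn F (carrier S) ∧ ∀ p ∈ carrier S, (F p : AddCircle (1 : ℝ)) = Φ p := by
  classical
  have := hS.simplyConnectedSpace
  have := locallyPathConnectedSpace_carrier S
  obtain ⟨x₀, hx₀⟩ := hS.nonempty
  obtain ⟨e₀, he₀⟩ := QuotientAddGroup.mk_surjective (Φ x₀)
  obtain ⟨f, ⟨-, hf⟩, -⟩ := (AddCircle.isCoveringMap_coe (1 : ℝ)).existsUnique_continuousMap_lifts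
    ⟨fun p : carrier S => Φ p, continuousOn_iff_continuous_domRestrict.mp hΦ⟩ ⟨x₀, hx₀⟩ e₀ he₀
  refine ⟨fun p => if hp : p ∈ carrier S then f ⟨p, hp⟩ else 0, ?_, ?_⟩
  · rw [continuousOn_iff_continuous_domRestrict]
    convert f.continuous using 1
    ext p
    simp
  · intro p hp
    have h := congrFun hf ⟨p, hp⟩
    simp only [hp, dif_pos]
    exact h

/-- Such a function is integer valued, hence constant on the connected interval. -/
theorem eq_of_coe_eq_zero (g : ℝ → ℝ) (hg : ContinuousOn g (Set.Icc 0 1))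
    (h : ∀ s ∈ Set.Icc (0 : ℝ) 1, (g s : AddCircle (1 : ℝ)) = 0) : g 0 = g 1 := by
  have hd : IsDiscrete (Set.range ((↑) : ℤ → ℝ)) :=
    Int.isClosedEmbedding_coe_real.isEmbedding.isDiscrete_range
  refine isPreconnected_Icc.constant_of_mapsTo hd hg ?_ (by simp) (by simp)
  intro s hs
  obtain ⟨n, hn⟩ := (AddCircle.coe_eq_zero_iff (1 : ℝ)).mp (h s hs)
  exact ⟨n, by simpa using hn⟩

/-- The increment of a lift along a segment inside a cube. -/
theorem lift_increment (S : Finset Cell) (Φ : (Fin 3 → ℝ) → AddCircle (1 : ℝ))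
    (F : (Fin 3 → ℝ) → ℝ) (hF : ContinuousOn F (carrier S))
    (hΦ : ∀ p ∈ carrier S, (F p : AddCircle (1 : ℝ)) = Φ p) (c : Cell) (hc : c ∈ S)
    (p q : Fin 3 → ℝ) (hp : p ∈ cube c) (hq : q ∈ cube c) (l : ℝ → ℝ) (hl : Continuous l)
    (h : ∀ s ∈ Set.Icc (0 : ℝ) 1, Φ (AffineMap.lineMap p q s) = (l s : AddCircle (1 : ℝ))) :
    F q - F p = l 1 - l 0 := by
  have hm : ∀ s ∈ Set.Icc (0 : ℝ) 1, AffineMap.lineMap p q s ∈ carrier S := fun s hs =>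
    Set.mem_biUnion hc ((convex_Icc _ _).lineMap_mem hp hq hs)
  have := eq_of_coe_eq_zero (fun s => F (AffineMap.lineMap p q s) - l s) ?_ ?_
  · simp only [AffineMap.lineMap_apply_zero, AffineMap.lineMap_apply_one] at this
    linarith
  · refine ContinuousOn.sub (hF.comp (AffineMap.lineMap_continuous.continuousOn) hm) hl.continuousOn
  · intro s hs
    rw [AddCircle.coe_sub, hΦ _ (hm s hs), h s hs, sub_self]

/-- The angle function around the open cell `(a, b)` of the plane: it increases by one turn along
the upward ray from this cell, and is locally constant elsewhere. -/
noncomputable def turn (a b : ℤ) (p : Fin 3 → ℝ) : AddCircle (1 : ℝ) :=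
  if (b : ℝ) + 1 ≤ p 1 then ((max 0 (min (p 0 - a) 1) : ℝ) : AddCircle (1 : ℝ)) else 0

theorem coe_clamp_eq_zero {x : ℝ} (h : x ≤ 0 ∨ 1 ≤ x) :
    ((max 0 (min x 1) : ℝ) : AddCircle (1 : ℝ)) = 0 := by
  rcases h with h | h
  · rw [max_eq_left ((min_le_left _ _).trans h), AddCircle.coe_zero]
  · rw [min_eq_right h, max_eq_right zero_le_one]
    exact AddCircle.coe_period 1

/-- Checked cube by cube. Below the row of the missing cell the angle is zero; in that row the clamp
takes only the values `0` and `1`, which agree modulo one; above it the angle is the continuous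
clamp. -/
theorem continuousOn_turn (a b : ℤ) (S : Finset Cell) (h : ∀ c ∈ S, ¬ (c 0 = a ∧ c 1 = b)) :
    ContinuousOn (turn a b) (carrier S) := by
  refine continuousOn_carrier S _ fun c hc => ?_
  rcases lt_trichotomy (c 1) b with h1 | h1 | h1
  · refine (continuousOn_const (c := (0 : AddCircle (1 : ℝ)))).congr fun p hp => ?_
    have := hp.2 1
    have h1' : (c 1 : ℝ) + 1 ≤ b := by exact_mod_cast h1
    simp only at this
    rw [turn, if_neg (by linarith)]
  · refine (continuousOn_const (c := (0 : AddCircle (1 : ℝ)))).congr fun p hp => ?_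
    have h0 : c 0 ≠ a := fun h0 => h c hc ⟨h0, h1⟩
    have hp1 := hp.1 0
    have hp2 := hp.2 0
    simp only at hp1 hp2
    have : p 0 - a ≤ 0 ∨ 1 ≤ p 0 - a := by
      rcases lt_or_gt_of_ne h0 with h0 | h0
      · have : (c 0 : ℝ) + 1 ≤ a := by exact_mod_cast h0
        left; linarith
      · have : (a : ℝ) + 1 ≤ c 0 := by exact_mod_cast h0
        right; linarith
    simp only [turn, coe_clamp_eq_zero this, ite_self]
  · have : ContinuousOn (fun p : Fin 3 → ℝ =>
        ((max 0 (min (p 0 - a) 1) : ℝ) : AddCircle (1 : ℝ))) (cube c) := by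
      have h2 : Continuous fun p : Fin 3 → ℝ => max 0 (min (p 0 - (a : ℝ)) 1) := by fun_prop
      exact ((AddCircle.continuous_mk' (1 : ℝ)).comp h2).continuousOn
    refine this.congr fun p hp => ?_
    have := hp.1 1
    have h1' : (b : ℝ) + 1 ≤ c 1 := by exact_mod_cast h1
    simp only at this
    rw [turn, if_pos (by linarith)]

/-- On a simply connected region, the angle around a missing cell lifts at lattice points. -/
theorem exists_angle (D : Finset (ℤ × ℤ))
    (hD : IsSimplyConnected (carrier (D.image fun v => cell v 0))) (a b : ℤ) (hab : (a, b) ∉ D) :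
    ∃ θ : ℤ → ℤ → ℝ,
      (∀ x y, (x, y) ∈ D ∨ (x, y - 1) ∈ D → θ (x + 1) y - θ x y = if x = a ∧ b < y then 1 else 0) ∧
      (∀ x y, (x, y) ∈ D ∨ (x - 1, y) ∈ D → θ x (y + 1) = θ x y) := by
  have hc := continuousOn_turn a b (D.image fun v => cell v 0) (by
    intro c hc
    obtain ⟨⟨x, y⟩, hv, rfl⟩ := Finset.mem_image.mp hc
    rintro ⟨h0, h1⟩
    simp only [cell, Matrix.cons_val_zero, Matrix.cons_val_one] at h0 h1
    subst h0 h1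
    exact hab hv)
  obtain ⟨F, hF, hFt⟩ := exists_lift _ hD _ hc
  have mem : ∀ (v : ℤ × ℤ) (x y : ℤ), (x = v.1 ∨ x = v.1 + 1) → (y = v.2 ∨ y = v.2 + 1) →
      (![(x : ℝ), (y : ℝ), 0] : Fin 3 → ℝ) ∈ cube (cell v 0) := by
    rintro ⟨p, q⟩ x y hx hy
    simp only at hx hy
    constructor <;> intro i <;> fin_cases i <;> simp [cell] <;> norm_cast <;> omega
  have key : ∀ (v : ℤ × ℤ) (x y x' y' : ℤ) (l : ℝ → ℝ), v ∈ D →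
      (x = v.1 ∨ x = v.1 + 1) → (y = v.2 ∨ y = v.2 + 1) →
      (x' = v.1 ∨ x' = v.1 + 1) → (y' = v.2 ∨ y' = v.2 + 1) → Continuous l →
      (∀ s ∈ Set.Icc (0 : ℝ) 1, turn a b (AffineMap.lineMap
        (![(x : ℝ), (y : ℝ), 0] : Fin 3 → ℝ) ![(x' : ℝ), (y' : ℝ), 0] s) = l s) →
      F ![(x' : ℝ), (y' : ℝ), 0] - F ![(x : ℝ), (y : ℝ), 0] = l 1 - l 0 :=
    fun v x y x' y' l hv hx hy hx' hy' hl h => lift_increment _ _ F hF hFt (cell v 0)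
      (Finset.mem_image_of_mem _ hv) _ _ (mem v x y hx hy) (mem v x' y' hx' hy') l hl h
  refine ⟨fun x y => F ![(x : ℝ), (y : ℝ), 0], fun x y h => ?_, fun x y h => ?_⟩
  · have hl : ∀ s ∈ Set.Icc (0 : ℝ) 1, turn a b (AffineMap.lineMap
        (![(x : ℝ), (y : ℝ), 0] : Fin 3 → ℝ) ![((x + 1 : ℤ) : ℝ), (y : ℝ), 0] s) =
        ((if x = a ∧ b < y then s else 0 : ℝ) : AddCircle (1 : ℝ)) := by
      rintro s ⟨hs0, hs1⟩
      have e0 : (AffineMap.lineMap (![(x : ℝ), (y : ℝ), 0] : Fin 3 → ℝ)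
          ![((x + 1 : ℤ) : ℝ), (y : ℝ), 0] s) 0 = x + s := by
        simp [AffineMap.lineMap_apply]; ring
      have e1 : (AffineMap.lineMap (![(x : ℝ), (y : ℝ), 0] : Fin 3 → ℝ)
          ![((x + 1 : ℤ) : ℝ), (y : ℝ), 0] s) 1 = y := by
        simp [AffineMap.lineMap_apply]
      rw [turn, e0, e1]
      have hby : (b : ℝ) + 1 ≤ y ↔ b < y := by exact_mod_cast Int.add_one_le_iff
      by_cases hy : b < y
      · rw [if_pos (hby.mpr hy)]
        rcases lt_trichotomy x a with hx | hx | hx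
        · have : (x : ℝ) + 1 ≤ a := by exact_mod_cast hx
          rw [coe_clamp_eq_zero (by left; linarith), if_neg (by omega), AddCircle.coe_zero]
        · subst hx
          simp [hy, hs0, hs1]
        · have : (a : ℝ) + 1 ≤ x := by exact_mod_cast hx
          rw [coe_clamp_eq_zero (by right; linarith), if_neg (by omega), AddCircle.coe_zero]
      · rw [if_neg (by rwa [hby]), if_neg (fun h => hy h.2), AddCircle.coe_zero]
    have hcont : Continuous fun s : ℝ => if x = a ∧ b < y then s else 0 := by
      split_ifs <;> fun_prop
    have : F ![((x + 1 : ℤ) : ℝ), (y : ℝ), 0] - F ![(x : ℝ), (y : ℝ), 0] =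
        (if x = a ∧ b < y then 1 else 0) - (if x = a ∧ b < y then 0 else 0) := by
      rcases h with h | h
      · exact key _ x y (x + 1) y _ h (by simp) (by simp) (by simp) (by simp) hcont hl
      · exact key _ x y (x + 1) y _ h (by simp) (by simp) (by simp) (by simp) hcont hl
    simpa using this
  · have hl : ∀ s ∈ Set.Icc (0 : ℝ) 1, turn a b (AffineMap.lineMap
        (![(x : ℝ), (y : ℝ), 0] : Fin 3 → ℝ) ![(x : ℝ), ((y + 1 : ℤ) : ℝ), 0] s) =
        ((0 : ℝ) : AddCircle (1 : ℝ)) := by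
      rintro s ⟨hs0, hs1⟩
      have e0 : (AffineMap.lineMap (![(x : ℝ), (y : ℝ), 0] : Fin 3 → ℝ)
          ![(x : ℝ), ((y + 1 : ℤ) : ℝ), 0] s) 0 = x := by
        simp [AffineMap.lineMap_apply]
      have : (x : ℝ) - a ≤ 0 ∨ 1 ≤ (x : ℝ) - a := by
        rcases le_or_gt x a with hx | hx
        · have : (x : ℝ) ≤ a := by exact_mod_cast hx
          left; linarith
        · have : (a : ℝ) + 1 ≤ x := by exact_mod_cast hx
          right; linarith
      rw [turn, e0, coe_clamp_eq_zero this, ite_self, AddCircle.coe_zero]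
    have : F ![(x : ℝ), ((y + 1 : ℤ) : ℝ), 0] - F ![(x : ℝ), (y : ℝ), 0] = 0 - 0 := by
      rcases h with h | h
      · exact key _ x y x (y + 1) _ h (by simp) (by simp) (by simp) (by simp) continuous_const hl
      · exact key _ x y x (y + 1) _ h (by simp) (by simp) (by simp) (by simp) continuous_const hl
    have := sub_eq_zero.mp (this.trans (sub_zero 0))
    exact this

/-- Discrete Stokes in one direction: the two sums differ only by terms on the boundary of `K`,
where `f` vanishes. -/
theorem sum_eq_sum_shift {M : Type*} [AddCommMonoid M] (K : Finset (ℤ × ℤ)) (e : ℤ × ℤ)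
    (f : ℤ × ℤ → M) (hf : ∀ k, ¬ (k ∈ K ↔ k - e ∈ K) → f k = 0) :
    ∑ k ∈ K, f k = ∑ k ∈ K, f (k + e) := by
  classical
  have h1 : ∑ k ∈ K, f (k + e) = ∑ k ∈ K.image (· + e), f k :=
    (Finset.sum_image (by simp)).symm
  have hm : ∀ k, k ∈ K.image (· + e) ↔ k - e ∈ K := by
    intro k
    simp only [Finset.mem_image]
    exact ⟨fun ⟨a, ha, h⟩ => by rw [← h]; simpa using ha, fun h => ⟨_, h, by simp⟩⟩
  rw [h1, ← Finset.sum_subset (Finset.inter_subset_left (s₁ := K) (s₂ := K.image (· + e))),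
    ← Finset.sum_subset (Finset.inter_subset_right (s₁ := K) (s₂ := K.image (· + e)))]
  · intro k hk hk'
    refine hf k fun h => hk' ?_
    rw [Finset.mem_inter]
    exact ⟨h.mpr ((hm k).mp hk), hk⟩
  · intro k hk hk'
    refine hf k fun h => hk' ?_
    rw [Finset.mem_inter]
    exact ⟨hk, (hm k).mpr (h.mp hk)⟩

/-- A simply connected planar region of cells encloses no hole. -/
theorem holeFree_of_isSimplyConnected (D : Finset (ℤ × ℤ))
    (hD : IsSimplyConnected (carrier (D.image fun v => cell v 0))) : HoleFree D := by
  intro K hK hN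
  by_contra hne
  obtain ⟨⟨a, b⟩, hab⟩ := Finset.nonempty_iff_ne_empty.mpr hne
  obtain ⟨θ, h1, h2⟩ := exists_angle D hD a b (hK _ hab)
  -- `β` (lower sides) and `ρ` (left sides) measure how far `θ` is from having the prescribed
  -- increments. Both vanish on the sides separating `K` from `D`, yet their circulations around
  -- single cells of `K` add up to the indicator of `(a, b)`, which has total one.
  let β : ℤ × ℤ → ℝ := fun k =>
    (if k.1 = a ∧ b < k.2 then 1 else 0) - (θ (k.1 + 1) k.2 - θ k.1 k.2)
  let ρ : ℤ × ℤ → ℝ := fun k => θ k.1 (k.2 + 1) - θ k.1 k.2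
  have hβ := sum_eq_sum_shift K (0, 1) β (by
    rintro ⟨x, y⟩ h
    have : (x, y) ∈ D ∨ (x, y - 1) ∈ D := by
      by_cases hk : (x, y) ∈ K
      · right
        refine (hN _ hk (x, y - 1) (by simp [Nbr])).resolve_left fun h' => h ?_
        simpa [hk] using h'
      · have hk' : (x, y - 1) ∈ K := by
          by_contra h'
          apply h
          simp [hk, h']
        left
        exact (hN _ hk' (x, y) (by simp [Nbr])).resolve_left hk
    simp only [β, h1 x y this, sub_self])
  have hρ := sum_eq_sum_shift K (1, 0) ρ (by
    rintro ⟨x, y⟩ h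
    have : (x, y) ∈ D ∨ (x - 1, y) ∈ D := by
      by_cases hk : (x, y) ∈ K
      · right
        refine (hN _ hk (x - 1, y) (by simp [Nbr])).resolve_left fun h' => h ?_
        simpa [hk] using h'
      · have hk' : (x - 1, y) ∈ K := by
          by_contra h'
          apply h
          simp [hk, h']
        left
        exact (hN _ hk' (x, y) (by simp [Nbr])).resolve_left hk
    simp only [ρ, h2 x y this, sub_self])
  have : ∑ k ∈ K, (if k = (a, b) then (1 : ℝ) else 0) = 0 := by
    calc ∑ k ∈ K, (if k = (a, b) then (1 : ℝ) else 0)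
        = ∑ k ∈ K, (β (k + (0, 1)) - β k - (ρ k - ρ (k + (1, 0))) ) := by
          refine Finset.sum_congr rfl ?_
          rintro ⟨x, y⟩ -
          simp only [β, ρ, Prod.mk_add_mk, add_zero, Prod.mk.injEq]
          by_cases hx : x = a
          · rcases lt_trichotomy y b with hy | hy | hy
            · rw [if_neg (by omega), if_neg (by omega), if_neg (by omega)]; ring
            · rw [if_pos (by omega), if_pos (by omega), if_neg (by omega)]; ring
            · rw [if_neg (by omega), if_pos (by omega), if_pos (by omega)]; ring
          · rw [if_neg (by omega), if_neg (by omega), if_neg (by omega)]; ring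
      _ = 0 := by
          clear_value β ρ
          rw [Finset.sum_sub_distrib, Finset.sum_sub_distrib, Finset.sum_sub_distrib, ← hβ, ← hρ]
          ring
  rw [Finset.sum_ite_eq' K (a, b), if_pos hab] at this
  exact one_ne_zero this

/-! ### Even edge sets, heights modulo two and the Euler inequality -/

theorem zmod2_add_self (a : ZMod 2) : a + a = 0 := CharTwo.add_self_eq_zero a

/-- A finite edge set of the square lattice with even degrees is the boundary of a finite set of
faces; everything is encoded by functions to `ZMod 2`. `H (x, y)` and `V (x, y)` are the
values on the lower and on the left side of the face with lower left corner `(x, y)`. -/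
theorem exists_height (H V : ℤ × ℤ → ZMod 2) (S : Finset (ℤ × ℤ))
    (hH : ∀ v, v ∉ S → H v = 0) (hV : ∀ v, v ∉ S → V v = 0)
    (heven : ∀ x y, H (x, y) + H (x - 1, y) + V (x, y) + V (x, y - 1) = 0) :
    ∃ (h : ℤ × ℤ → ZMod 2) (B : Finset (ℤ × ℤ)), (∀ v, v ∉ B → h v = 0) ∧
      (∀ x y, h (x, y) + h (x, y - 1) = H (x, y)) ∧
      (∀ x y, h (x, y) + h (x - 1, y) = V (x, y)) := by
  obtain ⟨⟨px, py⟩, hp⟩ := S.bddAbove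
  obtain ⟨⟨qx, qy⟩, hq⟩ := S.bddBelow
  have hbox : ∀ x y, (x, y) ∈ S → qx ≤ x ∧ x ≤ px ∧ qy ≤ y ∧ y ≤ py := fun x y h =>
    ⟨(hq h).1, (hp h).1, (hq h).2, (hp h).2⟩
  -- Crossing number of the horizontal ray from the face to the left, cut off at a bounding box of
  -- `S`.
  let h : ℤ × ℤ → ZMod 2 := fun v => ∑ k ∈ Finset.Icc qx v.1, V (k, v.2)
  have h0 : ∀ x y, x < qx → h (x, y) = 0 := fun x y hx => by
    simp [h, Finset.Icc_eq_empty (show ¬ qx ≤ x by omega)]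
  have hrec : ∀ x y, h (x, y) = h (x - 1, y) + V (x, y) := by
    intro x y
    by_cases hx : qx ≤ x
    · have : Finset.Icc qx x = insert x (Finset.Icc qx (x - 1)) := by
        ext k; simp only [Finset.mem_Icc, Finset.mem_insert]; omega
      simp only [h]
      rw [this, Finset.sum_insert (by simp), add_comm]
    · rw [h0 x y (by omega), h0 (x - 1) y (by omega), hV (x, y) (fun hs => hx (hbox x y hs).1),
        add_zero]
  have h2 : ∀ x y, h (x, y) + h (x - 1, y) = V (x, y) := fun x y => by
    rw [hrec x y]; linear_combination zmod2_add_self (h (x - 1, y))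
  have h1 : ∀ x y, h (x, y) + h (x, y - 1) = H (x, y) := by
    intro x y
    by_cases hx : qx - 1 ≤ x
    · induction x, hx using Int.leInduction with
      | base =>
        rw [h0 _ _ (by omega), h0 _ _ (by omega), hH _ fun hs => ?_, add_zero]
        have := (hbox _ _ hs).1
        omega
      | succ x _ ih =>
        have e := heven (x + 1) y
        have a1 := hrec (x + 1) y
        have a2 := hrec (x + 1) (y - 1)
        rw [add_sub_cancel_right] at e a1 a2
        linear_combination a1 + a2 + ih - e + zmod2_add_self (V (x + 1, y)) +
          zmod2_add_self (V (x + 1, y - 1)) + zmod2_add_self (H (x, y))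
    · rw [h0 _ _ (by omega), h0 _ _ (by omega), hH _ fun hs => ?_, add_zero]
      have := (hbox _ _ hs).1
      omega
  refine ⟨h, Finset.Icc (qx, qy) (px, py), ?_, h1, h2⟩
  rintro ⟨x, y⟩ hv
  have hrow : ∀ y, (y < qy ∨ py < y) → h (x, y) = 0 := fun y hy =>
    Finset.sum_eq_zero fun k _ => hV _ fun hs => by
      have := hbox _ _ hs
      simp only at this
      omega
  by_cases hx : x < qx
  · exact h0 x y hx
  by_cases hy : y < qy
  · exact hrow y (Or.inl hy)
  by_cases hy' : py < y
  · exact hrow y (Or.inr hy')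
  -- Only faces to the right of the box remain. There `H` vanishes, so the value zero below the box
  -- propagates upwards.
  have hx' : px < x := by
    by_contra hx'
    exact hv (Finset.mem_Icc.mpr ⟨⟨by simpa using hx, by simpa using hy⟩,
      ⟨by simpa using hx', by simpa using hy'⟩⟩)
  have hqy : qy - 1 ≤ y := by omega
  clear hy hy' hv
  induction y, hqy using Int.leInduction with
  | base => exact hrow _ (Or.inl (by omega))
  | succ y _ ih =>
    have e := h1 x (y + 1)
    rw [add_sub_cancel_right, ih, add_zero, hH] at e
    · exact e
    · intro hs
      have := hbox _ _ hs
      omega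

/-- A finitely supported height without jumps at vertices outside a hole-free set vanishes on all
faces around such vertices. -/
theorem height_eq_zero (S : Finset (ℤ × ℤ)) (hS : HoleFree S) (H V h : ℤ × ℤ → ZMod 2)
    (B : Finset (ℤ × ℤ)) (hB : ∀ v, v ∉ B → h v = 0)
    (h1 : ∀ x y, h (x, y) + h (x, y - 1) = H (x, y))
    (h2 : ∀ x y, h (x, y) + h (x - 1, y) = V (x, y))
    (hout : ∀ x y, (x, y) ∉ S → H (x, y) = 0 ∧ H (x - 1, y) = 0 ∧ V (x, y) = 0 ∧ V (x, y - 1) = 0)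
    (x y : ℤ) (hxy : (x, y) ∉ S) :
    h (x, y) = 0 ∧ h (x - 1, y) = 0 ∧ h (x, y - 1) = 0 ∧ h (x - 1, y - 1) = 0 := by
  have eq : ∀ x y, (x, y) ∉ S →
      h (x - 1, y) = h (x, y) ∧ h (x, y - 1) = h (x, y) ∧ h (x - 1, y - 1) = h (x, y) := by
    intro x y hv
    obtain ⟨e1, e2, e3, e4⟩ := hout x y hv
    have a1 := h1 x y
    have a2 := h1 (x - 1) y
    have a3 := h2 x y
    rw [e1] at a1
    rw [e2] at a2
    rw [e3] at a3
    have b1 := CharTwo.add_eq_zero.mp a1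
    have b2 := CharTwo.add_eq_zero.mp a2
    have b3 := CharTwo.add_eq_zero.mp a3
    exact ⟨b3.symm, b1.symm, by rw [← b2, b3]⟩
  -- The four faces around a vertex outside `S` have equal height, and adjacent vertices outside `S`
  -- share a face. So the vertices outside `S` of nonzero height form a finite set enclosed by `S`.
  have hU := hS (B.filter fun v => v ∉ S ∧ h v ≠ 0) (by simp +contextual) (by
    rintro ⟨x, y⟩ hu ⟨x', y'⟩ hn
    simp only [Finset.mem_filter] at hu ⊢
    obtain ⟨-, hu, hh⟩ := hu
    by_cases hv : (x', y') ∈ S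
    · exact Or.inr hv
    left
    have : h (x', y') = h (x, y) := by
      obtain ⟨a1, a2, a3⟩ := eq x y hu
      obtain ⟨b1, b2, b3⟩ := eq x' y' hv
      simp only [Nbr] at hn
      rcases hn with ⟨rfl, rfl⟩ | ⟨rfl, rfl⟩ | ⟨rfl, rfl⟩ | ⟨rfl, rfl⟩
      · rw [← b1, add_sub_cancel_right]
      · exact a1
      · rw [← b2, add_sub_cancel_right]
      · exact a2
    refine ⟨?_, hv, by rwa [this]⟩
    by_contra hb
    exact hh (this ▸ hB _ hb))
  have h0 : h (x, y) = 0 := by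
    by_contra hh
    have : (x, y) ∈ B.filter fun v => v ∉ S ∧ h v ≠ 0 := by
      simp only [Finset.mem_filter]
      exact ⟨by_contra fun hb => hh (hB _ hb), hxy, hh⟩
    rw [hU] at this
    simp at this
  obtain ⟨a1, a2, a3⟩ := eq x y hxy
  rw [a1, a2, a3]
  exact ⟨h0, h0, h0, h0⟩

/-- Left ends of the horizontal edges between elements of `Q`. -/
def hEdges (Q : Finset (ℤ × ℤ)) : Finset (ℤ × ℤ) := Q.filter fun v => v + (1, 0) ∈ Q

/-- Lower ends of the vertical edges between elements of `Q`. -/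
def vEdges (Q : Finset (ℤ × ℤ)) : Finset (ℤ × ℤ) := Q.filter fun v => v + (0, 1) ∈ Q

/-- Lower left corners of the `2 × 2` blocks in `Q`. -/
def blocks (Q : Finset (ℤ × ℤ)) : Finset (ℤ × ℤ) :=
  Q.filter fun v => v + (1, 0) ∈ Q ∧ v + (0, 1) ∈ Q ∧ v + (1, 1) ∈ Q

/-- Extension by zero of a function on a finite set. -/
noncomputable def extendZero (E : Finset (ℤ × ℤ)) : (E → ZMod 2) →ₗ[ZMod 2] (ℤ × ℤ → ZMod 2) :=
  Function.ExtendByZero.linearMap _ Subtype.val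

theorem extendZero_of_mem {E : Finset (ℤ × ℤ)} (f : E → ZMod 2) {v : ℤ × ℤ} (hv : v ∈ E) :
    extendZero E f v = f ⟨v, hv⟩ :=
  Subtype.val_injective.extend_apply f 0 ⟨v, hv⟩

theorem extendZero_of_notMem {E : Finset (ℤ × ℤ)} (f : E → ZMod 2) {v : ℤ × ℤ} (hv : v ∉ E) :
    extendZero E f v = 0 :=
  Function.extend_apply' (f := Subtype.val) f 0 v (by rintro ⟨a, rfl⟩; exact hv a.2)

/-- The degree of every vertex in an edge set of `Q`, modulo two. -/
noncomputable def degreeMap (Q : Finset (ℤ × ℤ)) :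
    ((hEdges Q → ZMod 2) × (vEdges Q → ZMod 2)) →ₗ[ZMod 2] (Q → ZMod 2) where
  toFun p v := extendZero _ p.1 v.1 + extendZero _ p.1 (v.1 - (1, 0)) + extendZero _ p.2 v.1 +
    extendZero _ p.2 (v.1 - (0, 1))
  map_add' p q := by
    ext v; simp only [Prod.fst_add, Prod.snd_add, map_add, Pi.add_apply]; ring
  map_smul' c p := by
    ext v
    simp only [Prod.smul_fst, Prod.smul_snd, map_smul, Pi.smul_apply, smul_eq_mul, RingHom.id_apply]
    ring

/-- The edges bounding a set of blocks, modulo two. -/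
noncomputable def boundaryMap (Q : Finset (ℤ × ℤ)) :
    (blocks Q → ZMod 2) →ₗ[ZMod 2] ((hEdges Q → ZMod 2) × (vEdges Q → ZMod 2)) where
  toFun h := (fun v => extendZero _ h v.1 + extendZero _ h (v.1 - (0, 1)),
    fun v => extendZero _ h v.1 + extendZero _ h (v.1 - (1, 0)))
  map_add' p q := by
    ext v <;> simp only [map_add, Pi.add_apply, Prod.fst_add, Prod.snd_add] <;> ring
  map_smul' c p := by
    ext v <;> simp only [map_smul, Pi.smul_apply, smul_eq_mul, RingHom.id_apply, Prod.smul_fst,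
      Prod.smul_snd] <;> ring

/-- Vanishing of the first homology modulo two: an even edge set is the boundary of its height, and
hole-freeness makes the height vanish off the blocks. -/
theorem ker_degreeMap_le (Q : Finset (ℤ × ℤ)) (hQ : HoleFree Q) :
    LinearMap.ker (degreeMap Q) ≤ LinearMap.range (boundaryMap Q) := by
  rintro ⟨f, g⟩ hfg
  rw [LinearMap.mem_ker] at hfg
  have hH : ∀ v, v ∉ Q → extendZero _ f v = 0 := fun v hv =>
    extendZero_of_notMem f fun h => hv (Finset.mem_filter.mp h).1
  have hV : ∀ v, v ∉ Q → extendZero _ g v = 0 := fun v hv =>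
    extendZero_of_notMem g fun h => hv (Finset.mem_filter.mp h).1
  have hout : ∀ x y, (x, y) ∉ Q → extendZero _ f (x, y) = 0 ∧ extendZero _ f (x - 1, y) = 0 ∧
      extendZero _ g (x, y) = 0 ∧ extendZero _ g (x, y - 1) = 0 := by
    intro x y hv
    refine ⟨hH _ hv, extendZero_of_notMem f fun h => hv ?_, hV _ hv,
      extendZero_of_notMem g fun h => hv ?_⟩
    · simpa using (Finset.mem_filter.mp h).2
    · simpa using (Finset.mem_filter.mp h).2
  obtain ⟨h, B, hB, h1, h2⟩ := exists_height (extendZero _ f) (extendZero _ g) Q hH hV (by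
    intro x y
    by_cases hv : (x, y) ∈ Q
    · have := congrFun hfg ⟨(x, y), hv⟩
      simpa [degreeMap] using this
    · obtain ⟨e1, e2, e3, e4⟩ := hout x y hv
      rw [e1, e2, e3, e4]; simp)
  have hz := height_eq_zero Q hQ _ _ h B hB h1 h2 hout
  have he : extendZero (blocks Q) (fun v => h v.1) = h := by
    ext ⟨x, y⟩
    by_cases hv : (x, y) ∈ blocks Q
    · rw [extendZero_of_mem _ hv]
    · rw [extendZero_of_notMem _ hv]
      by_contra hne
      apply hv
      refine Finset.mem_filter.mpr ⟨?_, ?_, ?_, ?_⟩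
      · by_contra h'
        exact hne (hz x y h').1.symm
      · by_contra h'
        have := (hz (x + 1) y (by simpa using h')).2.1
        rw [add_sub_cancel_right] at this
        exact hne this.symm
      · by_contra h'
        have := (hz x (y + 1) (by simpa using h')).2.2.1
        rw [add_sub_cancel_right] at this
        exact hne this.symm
      · by_contra h'
        have := (hz (x + 1) (y + 1) (by simpa using h')).2.2.2
        rw [add_sub_cancel_right, add_sub_cancel_right] at this
        exact hne this.symm
  refine ⟨fun v => h v.1, ?_⟩
  simp only [boundaryMap, LinearMap.coe_mk, AddHom.coe_mk, he]
  ext ⟨⟨x, y⟩, hv⟩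
  · simpa [extendZero_of_mem f hv] using h1 x y
  · simpa [extendZero_of_mem g hv] using h2 x y

/-- Every edge is counted at both of its ends. -/
theorem sum_degreeMap (Q : Finset (ℤ × ℤ)) (p) : ∑ v, degreeMap Q p v = 0 := by
  obtain ⟨f, g⟩ := p
  have h1 : ∑ v ∈ Q, extendZero _ f v = ∑ v ∈ Q, extendZero _ f (v - (1, 0)) := by
    have := sum_eq_sum_shift Q (1, 0) (fun v => extendZero _ f (v - (1, 0))) (by
      intro k hk
      refine extendZero_of_notMem f fun h => hk ?_
      have := Finset.mem_filter.mp h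
      simp only [sub_add_cancel] at this
      tauto)
    simpa using this.symm
  have h2 : ∑ v ∈ Q, extendZero _ g v = ∑ v ∈ Q, extendZero _ g (v - (0, 1)) := by
    have := sum_eq_sum_shift Q (0, 1) (fun v => extendZero _ g (v - (0, 1))) (by
      intro k hk
      refine extendZero_of_notMem g fun h => hk ?_
      have := Finset.mem_filter.mp h
      simp only [sub_add_cancel] at this
      tauto)
    simpa using this.symm
  simp only [degreeMap, LinearMap.coe_mk, AddHom.coe_mk]
  rw [Finset.sum_coe_sort Q fun v => extendZero _ f v + extendZero _ f (v - (1, 0)) +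
    extendZero _ g v + extendZero _ g (v - (0, 1)), Finset.sum_add_distrib, Finset.sum_add_distrib,
    Finset.sum_add_distrib, ← h1, ← h2, zmod2_add_self, zero_add, zmod2_add_self]

/-- The Euler characteristic of a nonempty hole-free set is positive. -/
theorem euler_inequality (Q : Finset (ℤ × ℤ)) (hQ : HoleFree Q) (hne : Q.Nonempty) :
    (hEdges Q).card + (vEdges Q).card + 1 ≤ Q.card + (blocks Q).card := by
  let σ : (Q → ZMod 2) →ₗ[ZMod 2] ZMod 2 := ∑ v, LinearMap.proj v
  have hσ : ∀ f, σ f = ∑ v, f v := fun f => by simp [σ]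
  -- With `V`, `E`, `F` vertices, edges and blocks: `degreeMap` has rank at most `V - 1`, since
  -- degrees sum to zero, and nullity at most `F`, since its kernel consists of boundaries. Hence `E
  -- ≤ V - 1 + F`.
  have h1 := LinearMap.finrank_range_add_finrank_ker (degreeMap Q)
  have h2 := LinearMap.finrank_range_add_finrank_ker σ
  have h3 : Module.finrank (ZMod 2) (LinearMap.range σ) = 1 := by
    rw [LinearMap.range_eq_top.mpr, finrank_top, Module.finrank_self]
    intro a
    obtain ⟨v, hv⟩ := hne
    exact ⟨Pi.single ⟨v, hv⟩ a, by rw [hσ]; simp⟩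
  have h4 : LinearMap.range (degreeMap Q) ≤ LinearMap.ker σ := by
    rintro _ ⟨p, rfl⟩
    rw [LinearMap.mem_ker, hσ, sum_degreeMap]
  have h5 := Submodule.finrank_mono h4
  have h6 := Submodule.finrank_mono (ker_degreeMap_le Q hQ)
  have h7 := LinearMap.finrank_range_le (boundaryMap Q)
  simp only [Module.finrank_prod, Module.finrank_fintype_fun_eq_card, Fintype.card_coe] at *
  omega

/-! ### A convex corner that is thin or solid -/

theorem card_filter_shift (Q : Finset (ℤ × ℤ)) (p r : ℤ × ℤ → Prop) [DecidablePred p]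
    [DecidablePred r] (e : ℤ × ℤ) (h : ∀ v, v ∈ Q ∧ p v ↔ v + e ∈ Q ∧ r (v + e)) :
    (Q.filter p).card = (Q.filter r).card := by
  refine Finset.card_nbij' (· + e) (· - e) ?_ ?_ ?_ ?_
  · intro v hv
    simp only [Finset.coe_filter, Set.mem_ofPred_eq] at hv ⊢
    exact (h v).mp hv
  · intro v hv
    simp only [Finset.coe_filter, Set.mem_ofPred_eq] at hv ⊢
    exact (h (v - e)).mpr (by simpa using hv)
  · intro v _; simp
  · intro v _; simp

/-- A nonempty hole-free set has a convex corner at which it is either thin or solid. -/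
theorem exists_ear (Q : Finset (ℤ × ℤ)) (hQ : HoleFree Q) (hne : Q.Nonempty) :
    ∃ x y ε δ : ℤ, (ε = 1 ∨ ε = -1) ∧ (δ = 1 ∨ δ = -1) ∧ (x, y) ∈ Q ∧
      (x + ε, y) ∉ Q ∧ (x, y + δ) ∉ Q ∧
      ((x - ε, y) ∉ Q ∨ (x, y - δ) ∉ Q ∨
        ((x - ε, y) ∈ Q ∧ (x, y - δ) ∈ Q ∧ (x - ε, y - δ) ∈ Q)) := by
  by_contra hcon
  push Not at hcon
  have hb : ∀ x y ε δ : ℤ, (ε = 1 ∨ ε = -1) → (δ = 1 ∨ δ = -1) → (x, y) ∈ Q →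
      (x + ε, y) ∈ Q ∨ (x, y + δ) ∈ Q ∨
        ((x - ε, y) ∈ Q ∧ (x, y - δ) ∈ Q ∧ (x - ε, y - δ) ∉ Q) := by
    intro x y ε δ h1 h2 h3
    by_cases h4 : (x + ε, y) ∈ Q
    · exact Or.inl h4
    by_cases h5 : (x, y + δ) ∈ Q
    · exact Or.inr (Or.inl h5)
    obtain ⟨a, b, c⟩ := hcon x y ε δ h1 h2 h3 h4 h5
    exact Or.inr (Or.inr ⟨a, b, c a b⟩)
  let i : Prop → ℤ := fun p => @ite ℤ p (Classical.dec p) 1 0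
  have hsum : ∀ (p : ℤ × ℤ → Prop) [DecidablePred p],
      ∑ v ∈ Q, i (p v) = ((Q.filter p).card : ℤ) := by
    intro p _
    rw [Finset.card_filter]
    push_cast
    exact Finset.sum_congr rfl fun v _ => by simp only [i]; congr
  -- Split twice the degree over the four quadrants at `v`: a quadrant contributes its number of
  -- neighbours, minus one, minus one more if it is a block. This is negative only for a quadrant
  -- with no neighbour, where it is `-1`; by `hb` the opposite quadrant then contributes `+1`.
  have hpt : ∀ v ∈ Q, 4 + (i (v + (1, 0) ∈ Q ∧ v + (0, 1) ∈ Q ∧ v + (1, 1) ∈ Q) +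
      i (v + (1, 0) ∈ Q ∧ v + (0, -1) ∈ Q ∧ v + (1, -1) ∈ Q) +
      i (v + (-1, 0) ∈ Q ∧ v + (0, 1) ∈ Q ∧ v + (-1, 1) ∈ Q) +
      i (v + (-1, 0) ∈ Q ∧ v + (0, -1) ∈ Q ∧ v + (-1, -1) ∈ Q)) ≤
      2 * (i (v + (1, 0) ∈ Q) + i (v + (-1, 0) ∈ Q) + i (v + (0, 1) ∈ Q) + i (v + (0, -1) ∈ Q)) := by
    rintro ⟨x, y⟩ hv
    have h1 := hb x y 1 1 (by simp) (by simp) hv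
    have h2 := hb x y 1 (-1) (by simp) (by simp) hv
    have h3 := hb x y (-1) 1 (by simp) (by simp) hv
    have h4 := hb x y (-1) (-1) (by simp) (by simp) hv
    simp only [sub_eq_add_neg, neg_neg] at h1 h2 h3 h4
    simp only [Prod.mk_add_mk, add_zero, i]
    generalize ((x + 1, y) ∈ Q) = r at *
    generalize ((x + -1, y) ∈ Q) = l at *
    generalize ((x, y + 1) ∈ Q) = u at *
    generalize ((x, y + -1) ∈ Q) = d at *
    by_cases r <;> by_cases l <;> by_cases u <;> by_cases d <;> simp_all <;> split_ifs <;> norm_num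
  have hs := Finset.sum_le_sum hpt
  simp only [Finset.sum_add_distrib, ← Finset.mul_sum, Finset.sum_const, nsmul_eq_mul] at hs
  rw [hsum fun v => v + (1, 0) ∈ Q ∧ v + (0, 1) ∈ Q ∧ v + (1, 1) ∈ Q,
    hsum fun v => v + (1, 0) ∈ Q ∧ v + (0, -1) ∈ Q ∧ v + (1, -1) ∈ Q,
    hsum fun v => v + (-1, 0) ∈ Q ∧ v + (0, 1) ∈ Q ∧ v + (-1, 1) ∈ Q,
    hsum fun v => v + (-1, 0) ∈ Q ∧ v + (0, -1) ∈ Q ∧ v + (-1, -1) ∈ Q,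
    hsum fun v => v + (1, 0) ∈ Q, hsum fun v => v + (-1, 0) ∈ Q,
    hsum fun v => v + (0, 1) ∈ Q, hsum fun v => v + (0, -1) ∈ Q] at hs
  -- Edges are seen from both ends and blocks from all four corners, so summing gives `4V + 4F ≤
  -- 4E`, against the Euler inequality.
  have c1 := card_filter_shift Q (fun v => v + (-1, 0) ∈ Q) (fun v => v + (1, 0) ∈ Q) (-1, 0) (by
    rintro ⟨x, y⟩; simp; tauto)
  have c2 := card_filter_shift Q (fun v => v + (0, -1) ∈ Q) (fun v => v + (0, 1) ∈ Q) (0, -1) (by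
    rintro ⟨x, y⟩; simp; tauto)
  have c3 := card_filter_shift Q (fun v => v + (1, 0) ∈ Q ∧ v + (0, -1) ∈ Q ∧ v + (1, -1) ∈ Q)
    (fun v => v + (1, 0) ∈ Q ∧ v + (0, 1) ∈ Q ∧ v + (1, 1) ∈ Q) (0, -1) (by
    rintro ⟨x, y⟩; simp; tauto)
  have c4 := card_filter_shift Q (fun v => v + (-1, 0) ∈ Q ∧ v + (0, 1) ∈ Q ∧ v + (-1, 1) ∈ Q)
    (fun v => v + (1, 0) ∈ Q ∧ v + (0, 1) ∈ Q ∧ v + (1, 1) ∈ Q) (-1, 0) (by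
    rintro ⟨x, y⟩; simp; tauto)
  have c5 := card_filter_shift Q (fun v => v + (-1, 0) ∈ Q ∧ v + (0, -1) ∈ Q ∧ v + (-1, -1) ∈ Q)
    (fun v => v + (1, 0) ∈ Q ∧ v + (0, 1) ∈ Q ∧ v + (1, 1) ∈ Q) (-1, -1) (by
    rintro ⟨x, y⟩; simp; tauto)
  rw [c1, c2, c3, c4, c5] at hs
  have he := euler_inequality Q hQ hne
  simp only [hEdges, vEdges, blocks] at he
  omega

/-! ### Filling holes and innermost regions -/

theorem holeFree_box (p q : ℤ × ℤ) : HoleFree (Finset.Icc p q) := by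
  intro U hU hN
  by_contra hne
  have hmem : ∀ x y, (x, y) ∈ U → ¬ (p.1 ≤ x ∧ p.2 ≤ y ∧ x ≤ q.1 ∧ y ≤ q.2) := fun x y h h' =>
    hU _ h (Finset.mem_Icc.mpr ⟨⟨h'.1, h'.2.1⟩, ⟨h'.2.2.1, h'.2.2.2⟩⟩)
  -- If `U` reached beyond the box in direction `e`, its farthest element would have a neighbour
  -- neither in `U` nor in the box.
  have key : ∀ (f : ℤ × ℤ → ℤ) (e : ℤ × ℤ) (m : ℤ), (∀ v, Nbr v (v + e)) →
      (∀ v, f (v + e) = f v + 1) → (∀ v ∈ Finset.Icc p q, f v ≤ m) → ∀ u ∈ U, f u ≤ m := by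
    intro f e m hn hf hm u hu
    by_contra hlt
    obtain ⟨w, hw, hmax⟩ := Finset.exists_max_image U f ⟨u, hu⟩
    rcases hN w hw _ (hn w) with h | h
    · have := hmax _ h
      rw [hf] at this
      omega
    · have h1 := hm _ h
      rw [hf] at h1
      have := hmax _ hu
      omega
  obtain ⟨⟨x, y⟩, hu⟩ := Finset.nonempty_iff_ne_empty.mpr hne
  have a1 := key (fun v => v.1) (1, 0) q.1 (by simp [Nbr]) (by simp)
    (fun v hv => (Finset.mem_Icc.mp hv).2.1) _ hu
  have a2 := key (fun v => v.2) (0, 1) q.2 (by simp [Nbr]) (by simp)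
    (fun v hv => (Finset.mem_Icc.mp hv).2.2) _ hu
  have a3 := key (fun v => -v.1) (-1, 0) (-p.1) (by simp [Nbr, sub_eq_add_neg])
    (by intro v; simp; ring)
    (fun v hv => neg_le_neg (Finset.mem_Icc.mp hv).1.1) _ hu
  have a4 := key (fun v => -v.2) (0, -1) (-p.2) (by simp [Nbr, sub_eq_add_neg])
    (by intro v; simp; ring)
    (fun v hv => neg_le_neg (Finset.mem_Icc.mp hv).1.2) _ hu
  simp only at a1 a2 a3 a4
  exact hmem x y hu (by omega)

/-- Filling the holes of `C` inside a hole-free set. -/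
theorem exists_fill (B C : Finset (ℤ × ℤ)) (hB : HoleFree B) (hC : C ⊆ B) :
    ∃ W, C ⊆ W ∧ W ⊆ B ∧ HoleFree W ∧ ∀ w ∈ W, (∃ v, Nbr w v ∧ v ∉ W) → w ∈ C := by
  classical
  -- Outside `C`, all elements of `T` must be interior. The property survives unions, so there is a
  -- largest such `T` in `B`; it has no holes because adjoining an enclosed set preserves the
  -- property.
  let P : Finset (ℤ × ℤ) → Prop := fun T => ∀ t ∈ T, t ∈ C ∨ ∀ v, Nbr t v → v ∈ T
  let W := (B.powerset.filter P).biUnion id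
  have hmem : ∀ T, T ⊆ B → P T → T ⊆ W := fun T hT hP =>
    Finset.subset_biUnion_of_mem id (Finset.mem_filter.mpr ⟨Finset.mem_powerset.mpr hT, hP⟩)
  have hWB : W ⊆ B := by
    refine Finset.biUnion_subset.mpr fun T hT => ?_
    exact Finset.mem_powerset.mp (Finset.mem_filter.mp hT).1
  have hW : P W := by
    intro t ht
    obtain ⟨T, hT, htT⟩ := Finset.mem_biUnion.mp ht
    obtain ⟨hT1, hT2⟩ := Finset.mem_filter.mp hT
    exact (hT2 t htT).imp_right fun h v hv => hmem T (Finset.mem_powerset.mp hT1) hT2 (h v hv)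
  refine ⟨W, hmem C hC fun t ht => Or.inl ht, hWB, ?_, ?_⟩
  · intro U hU hN
    have hUB : U ⊆ B := by
      have := hB (U.filter (· ∉ B)) (by simp) (by
        intro u hu v hv
        by_cases hvB : v ∈ B
        · exact Or.inr hvB
        · rcases hN u (Finset.mem_filter.mp hu).1 v hv with h | h
          · exact Or.inl (Finset.mem_filter.mpr ⟨h, hvB⟩)
          · exact Or.inr (hWB h))
      intro u hu
      by_contra hb
      have h' : u ∈ U.filter (· ∉ B) := Finset.mem_filter.mpr ⟨hu, hb⟩
      rw [this] at h'
      simp at h'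
    have : U ∪ W ⊆ W := hmem _ (Finset.union_subset hUB hWB) (by
      intro t ht
      rcases Finset.mem_union.mp ht with h | h
      · exact Or.inr fun v hv => Finset.mem_union.mpr (hN t h v hv)
      · exact (hW t h).imp_right fun h' v hv => Finset.mem_union_right _ (h' v hv))
    rw [← Finset.not_nonempty_iff_eq_empty]
    rintro ⟨u, hu⟩
    exact hU u hu (this (Finset.mem_union_left _ hu))
  · rintro w hw ⟨v, hv, hvW⟩
    exact (hW w hw).resolve_right fun h => hvW (h v hv)

/-- Given finitely supported height `h`, not identically zero, there is a nonempty hole-free set of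
faces on which `h` is constant and along whose boundary `h` jumps. -/
theorem exists_innermost (h : ℤ × ℤ → ZMod 2) (B : Finset (ℤ × ℤ)) (hB : ∀ v, v ∉ B → h v = 0)
    (hne : ∃ v, h v ≠ 0) :
    ∃ Q : Finset (ℤ × ℤ), Q.Nonempty ∧ HoleFree Q ∧
      ∀ v ∈ Q, ∀ w, Nbr v w → (w ∈ Q ↔ h v = h w) := by
  classical
  -- Constancy of `h` is not required here; it will follow from minimal cardinality.
  let P : Finset (ℤ × ℤ) → Prop := fun C =>
    C.Nonempty ∧ HoleFree C ∧ ∀ v ∈ C, ∀ w, Nbr v w → w ∉ C → h v ≠ h w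
  have hex : ∃ C, P C := by
    obtain ⟨p, hp⟩ := B.bddBelow
    obtain ⟨q, hq⟩ := B.bddAbove
    obtain ⟨v, hv⟩ := hne
    have hvB : v ∈ B := by_contra fun h' => hv (hB v h')
    obtain ⟨W, h1, h2, h3, h4⟩ := exists_fill (Finset.Icc p q) (B.filter fun v => h v ≠ 0)
      (holeFree_box p q)
      (fun w hw => Finset.mem_Icc.mpr ⟨hp (Finset.mem_filter.mp hw).1, hq (Finset.mem_filter.mp hw).1⟩)
    refine ⟨W, ⟨v, h1 (Finset.mem_filter.mpr ⟨hvB, hv⟩)⟩, h3, ?_⟩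
    intro v hv w hw hwW
    have hw0 : h w = 0 := by
      by_contra hw0
      exact hwW (h1 (Finset.mem_filter.mpr ⟨by_contra fun h' => hw0 (hB w h'), hw0⟩))
    rw [hw0]
    exact (Finset.mem_filter.mp (h4 v hv ⟨w, hw, hwW⟩)).2
  obtain ⟨C, hC, hmin⟩ : ∃ C, P C ∧ ∀ C', P C' → C.card ≤ C'.card := by
    obtain ⟨C, hC⟩ := hex
    have hn : ∃ n, ∃ C, P C ∧ C.card = n := ⟨_, C, hC, rfl⟩
    obtain ⟨C₀, h1, h2⟩ := Nat.find_spec hn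
    exact ⟨C₀, h1, fun C' hC' => h2 ▸ Nat.find_min' hn ⟨C', hC', rfl⟩⟩
  obtain ⟨hCn, hCh, hCb⟩ := hC
  -- Filling the level set of `a` inside `C` gives another candidate, so by minimality `C` itself;
  -- thus all boundary faces have height `a`. A topmost face is a boundary face, so only one value
  -- `a` can occur.
  have hfull : ∀ a, (∃ v ∈ C, h v = a) → ∀ w ∈ C, (∃ v, Nbr w v ∧ v ∉ C) → h w = a := by
    rintro a ⟨v, hv, hva⟩
    obtain ⟨W, h1, h2, h3, h4⟩ := exists_fill C (C.filter fun v => h v = a) hCh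
      (Finset.filter_subset _ _)
    have hPW : P W := by
      refine ⟨⟨v, h1 (Finset.mem_filter.mpr ⟨hv, hva⟩)⟩, h3, fun v hv w hw hwW => ?_⟩
      have hva := (Finset.mem_filter.mp (h4 v hv ⟨w, hw, hwW⟩)).2
      by_cases hwC : w ∈ C
      · intro hvw
        exact hwW (h1 (Finset.mem_filter.mpr ⟨hwC, by rw [← hvw, hva]⟩))
      · exact hCb v (h2 hv) w hw hwC
    have hWC : W = C := Finset.eq_of_subset_of_card_le h2 (hmin W hPW)
    subst hWC
    exact fun w hw hv => (Finset.mem_filter.mp (h4 w hw hv)).2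
  have htop : ∃ w ∈ C, ∃ v, Nbr w v ∧ v ∉ C := by
    obtain ⟨w, hw, hmax⟩ := Finset.exists_max_image C (fun v => v.2) hCn
    refine ⟨w, hw, w + (0, 1), by simp [Nbr], fun h' => ?_⟩
    have := hmax _ h'
    simp at this
  obtain ⟨w, hw, hw'⟩ := htop
  refine ⟨C, hCn, hCh, fun v hv u hu => ⟨fun huC => ?_, fun he => by_contra fun huC =>
    hCb v hv u hu huC he⟩⟩
  rw [← hfull (h v) ⟨v, hv, rfl⟩ w hw hw', hfull (h u) ⟨u, huC, rfl⟩ w hw hw']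

/-! ### Exchanging dimers in a tiling -/

theorem cell_inj {v w : ℤ × ℤ} {y z : ℤ} : cell v y = cell w z ↔ v = w ∧ y = z := by
  constructor
  · intro h
    have h0 := congrFun h 0
    have h1 := congrFun h 1
    have h2 := congrFun h 2
    simp only [cell, Matrix.cons_val] at h0 h1 h2
    exact ⟨Prod.ext h0 h1, h2⟩
  · rintro ⟨rfl, rfl⟩; rfl

theorem pair_eq_pair {α : Type*} [DecidableEq α] {a b c d : α}
    (h : ({a, b} : Finset α) = {c, d}) : (a = c ∧ b = d) ∨ (a = d ∧ b = c) := by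
  have := congrArg (fun s : Finset α => (s : Set α)) h
  simp only [Finset.coe_pair] at this
  exact Set.pair_eq_pair_iff.mp this

variable {R : Finset Cell}

theorem Tiling.eq_of_mem (t : Tiling R) {d e : Finset Cell} (hd : d ∈ t.dimers) (he : e ∈ t.dimers)
    {p : Cell} (hpd : p ∈ d) (hpe : p ∈ e) : d = e := by
  by_contra hne
  exact Finset.disjoint_left.mp (t.disjoint d hd e he hne) hpd hpe

theorem Tiling.partner_unique (t : Tiling R) {p q r : Cell} (h1 : {p, q} ∈ t.dimers)
    (h2 : {p, r} ∈ t.dimers) : q = r := by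
  have h := t.eq_of_mem h1 h2 (p := p) (by simp) (by simp)
  rcases pair_eq_pair h with h | h
  · exact h.2
  · exact h.2.trans h.1

theorem Tiling.subset (t : Tiling R) {d : Finset Cell} (hd : d ∈ t.dimers) : d ⊆ R := by
  conv_rhs => rw [← t.cover]
  exact Finset.subset_biUnion_of_mem id hd

theorem isDimer_pair {p q : Cell} : IsDimer {p, q} ↔ ∃ i, q = p + unit i ∨ p = q + unit i := by
  constructor
  · rintro ⟨i, c, h⟩
    refine ⟨i, ?_⟩
    rcases pair_eq_pair h with ⟨rfl, rfl⟩ | ⟨rfl, rfl⟩ <;> simp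
  · rintro ⟨i, rfl | rfl⟩
    · exact ⟨i, p, rfl⟩
    · exact ⟨i, q, Finset.pair_comm _ _⟩

theorem Tiling.exists_partner (t : Tiling R) {p : Cell} (hp : p ∈ R) : ∃ q, {p, q} ∈ t.dimers := by
  rw [← t.cover] at hp
  obtain ⟨d, hd, hpd⟩ := Finset.mem_biUnion.mp hp
  obtain ⟨i, c, rfl⟩ := t.isDimer d hd
  simp only [id, Finset.mem_insert, Finset.mem_singleton] at hpd
  rcases hpd with rfl | rfl
  · exact ⟨_, hd⟩
  · exact ⟨c, by rwa [Finset.pair_comm]⟩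

/-- The two cubes of a vertical dimer of a duplex region. -/
def IsJewel (d : Finset Cell) : Prop := ∃ v, d = {cell v 0, cell v 1}

open Classical in
/-- The number of vertical dimers. -/
noncomputable def jewels (t : Tiling R) : ℕ := (t.dimers.filter IsJewel).card

/-- `t'` arises from `t` by replacing the dimers in `A` by those in `B`, and vice versa. -/
structure Swap (t t' : Tiling R) (A B : Finset (Finset Cell)) : Prop where
  subset : A ⊆ t.dimers
  disjoint : Disjoint (t.dimers \ A) B
  dimers_eq : t'.dimers = t.dimers \ A ∪ B

theorem Swap.subset' {t t' : Tiling R} {A B} (h : Swap t t' A B) : B ⊆ t'.dimers := by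
  rw [h.dimers_eq]; exact Finset.subset_union_right

theorem Swap.dimers_eq' {t t' : Tiling R} {A B} (h : Swap t t' A B) :
    t.dimers = t'.dimers \ B ∪ A := by
  rw [h.dimers_eq, Finset.union_sdiff_right, Finset.sdiff_eq_self_of_disjoint h.disjoint,
    Finset.sdiff_union_of_subset h.subset]

open Classical in
theorem Swap.jewels {t t' : Tiling R} {A B} (h : Swap t t' A B) :
    jewels t' + (A.filter IsJewel).card = jewels t + (B.filter IsJewel).card := by
  have e1 : DominoBrick.jewels t' =
      ((t.dimers \ A).filter IsJewel).card + (B.filter IsJewel).card := by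
    rw [← Finset.card_union_of_disjoint (Finset.disjoint_filter_filter h.disjoint),
      ← Finset.filter_union, DominoBrick.jewels, h.dimers_eq]
  have e2 : DominoBrick.jewels t =
      ((t.dimers \ A).filter IsJewel).card + (A.filter IsJewel).card := by
    rw [← Finset.card_union_of_disjoint (Finset.disjoint_filter_filter Finset.sdiff_disjoint),
      ← Finset.filter_union, Finset.sdiff_union_of_subset h.subset, DominoBrick.jewels]
  omega

/-- Replacing some dimers of a tiling by dimers which cover the same cubes. -/
theorem Tiling.exists_swap (t : Tiling R) (A B : Finset (Finset Cell)) (hA : A ⊆ t.dimers)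
    (hB : ∀ d ∈ B, IsDimer d) (hBd : ∀ d ∈ B, ∀ e ∈ B, d ≠ e → Disjoint d e)
    (hAB : B.biUnion id = A.biUnion id) : ∃ t' : Tiling R, Swap t t' A B := by
  have hsep : ∀ d ∈ t.dimers \ A, ∀ e ∈ B, Disjoint d e := by
    intro d hd e he
    rw [Finset.disjoint_left]
    intro p hpd hpe
    have : p ∈ B.biUnion id := Finset.mem_biUnion.mpr ⟨e, he, hpe⟩
    rw [hAB] at this
    obtain ⟨f, hf, hpf⟩ := Finset.mem_biUnion.mp this
    rw [Finset.mem_sdiff] at hd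
    exact hd.2 (t.eq_of_mem hd.1 (hA hf) hpd hpf ▸ hf)
  have hdisj : Disjoint (t.dimers \ A) B := by
    rw [Finset.disjoint_left]
    intro d hd hdB
    obtain ⟨i, c, rfl⟩ := hB d hdB
    exact (Finset.disjoint_left.mp (hsep _ hd _ hdB) (Finset.mem_insert_self c _))
      (Finset.mem_insert_self c _)
  refine ⟨⟨t.dimers \ A ∪ B, ?_, ?_, ?_⟩, hA, hdisj, rfl⟩
  · intro d hd
    rcases Finset.mem_union.mp hd with hd | hd
    · exact t.isDimer d (Finset.mem_sdiff.mp hd).1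
    · exact hB d hd
  · intro d hd e he hne
    rcases Finset.mem_union.mp hd with hd | hd <;> rcases Finset.mem_union.mp he with he | he
    · exact t.disjoint d (Finset.mem_sdiff.mp hd).1 e (Finset.mem_sdiff.mp he).1 hne
    · exact hsep d hd e he
    · exact (hsep e he d hd).symm
    · exact hBd d hd e he hne
  · rw [Finset.union_biUnion, hAB, ← Finset.union_biUnion, Finset.sdiff_union_of_subset hA, t.cover]

/-! ### Flips -/

/-- A flip or a trit, whose inverse is also one. -/
def Move (s t : Tiling R) : Prop := (IsFlip s t ∨ IsTrit s t) ∧ (IsFlip t s ∨ IsTrit t s)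

/-- The corners of a lattice unit square in space, `p` and `s` being opposite. -/
def IsRect (p q r s : Cell) : Prop :=
  ∃ (i j : Fin 3) (u w : Cell), i ≠ j ∧ (u = unit i ∨ u = -unit i) ∧ (w = unit j ∨ w = -unit j) ∧
    q = p + u ∧ r = p + w ∧ s = p + u + w

/-- The dimers `pq`, `rs` can be flipped to `pr`, `qs`. -/
def CanFlip (t : Tiling R) (p q r s : Cell) : Prop :=
  ∃ t' : Tiling R, Move t t' ∧ Swap t t' {{p, q}, {r, s}} {{p, r}, {q, s}}

theorem canFlip_of_corner (t : Tiling R) (i j : Fin 3) (hij : i ≠ j) (p q r s : Cell)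
    (hq : q = p + unit i) (hr : r = p + unit j) (hs : s = p + unit i + unit j)
    (h1 : {p, q} ∈ t.dimers) (h2 : {r, s} ∈ t.dimers) : CanFlip t p q r s := by
  subst hq hr hs
  have hu : ∀ k l : Fin 3, k ≠ l → unit k l = 0 := fun k l h => by
    simp [unit, h.symm]
  have hs : ∀ k : Fin 3, unit k k = 1 := fun k => by simp [unit]
  have hd : Disjoint ({p, p + unit j} : Finset Cell) {p + unit i, p + unit i + unit j} := by
    rw [Finset.disjoint_left]
    intro x hx hx'
    simp only [Finset.mem_insert, Finset.mem_singleton] at hx hx'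
    have : x i = p i := by rcases hx with rfl | rfl <;> simp [hu j i hij.symm]
    have : x i = p i + 1 := by rcases hx' with rfl | rfl <;> simp [hu j i hij.symm, hs]
    omega
  obtain ⟨t', h⟩ := t.exists_swap {{p, p + unit i}, {p + unit j, p + unit i + unit j}}
    {{p, p + unit j}, {p + unit i, p + unit i + unit j}}
    (by intro d hd; simp only [Finset.mem_insert, Finset.mem_singleton] at hd
        rcases hd with rfl | rfl <;> assumption)
    (by intro d hd; simp only [Finset.mem_insert, Finset.mem_singleton] at hd
        rcases hd with rfl | rfl
        · exact ⟨j, p, rfl⟩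
        · exact ⟨j, p + unit i, rfl⟩)
    (by intro d h e h' hne; simp only [Finset.mem_insert, Finset.mem_singleton] at h h'
        rcases h with rfl | rfl <;> rcases h' with rfl | rfl
        · exact absurd rfl hne
        · exact hd
        · exact hd.symm
        · exact absurd rfl hne)
    (by ext p; simp; tauto)
  refine ⟨t', ⟨Or.inl ⟨p, i, j, hij, ?_, ?_⟩, Or.inl ⟨p, j, i, hij.symm, ?_, ?_⟩⟩, h⟩
  · rw [add_right_comm p (unit j) (unit i)]; exact h.subset
  · rw [add_right_comm p (unit j) (unit i)]; exact h.dimers_eq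
  · exact h.subset'
  · rw [add_right_comm p (unit j) (unit i)]; exact h.dimers_eq'

theorem CanFlip.reflect {t : Tiling R} {p q r s : Cell} (h : CanFlip t q p s r) :
    CanFlip t p q r s := by
  rw [CanFlip, Finset.pair_comm q p, Finset.pair_comm s r, Finset.pair_comm ({q, s} : Finset Cell) {p, r}] at h
  exact h

theorem CanFlip.exchange {t : Tiling R} {p q r s : Cell} (h : CanFlip t r s p q) :
    CanFlip t p q r s := by
  rw [CanFlip, Finset.pair_comm r p, Finset.pair_comm s q, Finset.pair_comm ({r, s} : Finset Cell) {p, q}] at h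
  exact h

/-- Two parallel dimers on the sides `pq` and `rs` of a square can be flipped. -/
theorem canFlip (t : Tiling R) {p q r s : Cell} (h : IsRect p q r s) (h1 : {p, q} ∈ t.dimers)
    (h2 : {r, s} ∈ t.dimers) : CanFlip t p q r s := by
  obtain ⟨i, j, u, w, hij, hu, hw, hq, hr, hs⟩ := h
  have h1' : {q, p} ∈ t.dimers := by rwa [Finset.pair_comm]
  have h2' : {s, r} ∈ t.dimers := by rwa [Finset.pair_comm]
  rcases hu with rfl | rfl <;> rcases hw with rfl | rfl
  · exact canFlip_of_corner t i j hij p q r s hq hr hs h1 h2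
  · exact (canFlip_of_corner t i j hij r s p q (by rw [hs, hr]; abel) (by rw [hr]; abel)
      (by rw [hq, hr]; abel) h2 h1).exchange
  · exact (canFlip_of_corner t i j hij q p s r (by rw [hq]; abel) (by rw [hs, hq])
      (by rw [hr, hq]; abel) h1' h2').reflect
  · exact (canFlip_of_corner t i j hij s r q p (by rw [hs, hr]; abel) (by rw [hs, hq]; abel)
      (by rw [hs]; abel) h2' h1').exchange.reflect

/-- The corners of a unit square in the plane, `d` and `b` being opposite. -/
def Sq (d c a b : ℤ × ℤ) : Prop :=
  ∃ ε δ : ℤ, (ε = 1 ∨ ε = -1) ∧ (δ = 1 ∨ δ = -1) ∧ b = (d.1 + ε, d.2 + δ) ∧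
    ((c = (d.1 + ε, d.2) ∧ a = (d.1, d.2 + δ)) ∨ (c = (d.1, d.2 + δ) ∧ a = (d.1 + ε, d.2)))

theorem Sq.swap {d c a b : ℤ × ℤ} (h : Sq d c a b) : Sq d a c b := by
  obtain ⟨ε, δ, h1, h2, h3, h4⟩ := h
  exact ⟨ε, δ, h1, h2, h3, h4.symm.imp And.symm And.symm⟩

theorem Sq.opposite {d c a b : ℤ × ℤ} (h : Sq d c a b) : Sq b c a d := by
  obtain ⟨dx, dy⟩ := d
  obtain ⟨ε, δ, h1, h2, rfl, h4⟩ := h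
  refine ⟨-ε, -δ, by omega, by omega, by ext <;> simp, ?_⟩
  rcases h4 with ⟨rfl, rfl⟩ | ⟨rfl, rfl⟩
  · right; constructor <;> ext <;> simp
  · left; constructor <;> ext <;> simp

theorem cell_add_unit_zero (v : ℤ × ℤ) (z : ℤ) : cell v z + unit 0 = cell (v.1 + 1, v.2) z := by
  ext i; fin_cases i <;> simp [cell, unit]

theorem cell_add_unit_one (v : ℤ × ℤ) (z : ℤ) : cell v z + unit 1 = cell (v.1, v.2 + 1) z := by
  ext i; fin_cases i <;> simp [cell, unit]

theorem cell_add_unit_two (v : ℤ × ℤ) (z : ℤ) : cell v z + unit 2 = cell v (z + 1) := by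
  ext i; fin_cases i <;> simp [cell, unit]

theorem cell_sub_unit_zero (v : ℤ × ℤ) (z : ℤ) : cell v z + -unit 0 = cell (v.1 - 1, v.2) z := by
  ext i; fin_cases i <;> simp [cell, unit, sub_eq_add_neg]

theorem cell_sub_unit_one (v : ℤ × ℤ) (z : ℤ) : cell v z + -unit 1 = cell (v.1, v.2 - 1) z := by
  ext i; fin_cases i <;> simp [cell, unit, sub_eq_add_neg]

theorem Sq.isRect {d c a b : ℤ × ℤ} (h : Sq d c a b) (z : ℤ) :
    IsRect (cell d z) (cell c z) (cell a z) (cell b z) := by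
  obtain ⟨ε, δ, h1, h2, rfl, h4⟩ := h
  have hx : ∃ u : Cell, (u = unit 0 ∨ u = -unit 0) ∧ ∀ y, cell (d.1, y) z + u = cell (d.1 + ε, y) z := by
    rcases h1 with rfl | rfl
    · exact ⟨_, Or.inl rfl, fun y => cell_add_unit_zero _ z⟩
    · exact ⟨_, Or.inr rfl, fun y => cell_sub_unit_zero _ z⟩
  have hy : ∃ u : Cell, (u = unit 1 ∨ u = -unit 1) ∧ ∀ x, cell (x, d.2) z + u = cell (x, d.2 + δ) z := by
    rcases h2 with rfl | rfl
    · exact ⟨_, Or.inl rfl, fun y => cell_add_unit_one _ z⟩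
    · exact ⟨_, Or.inr rfl, fun y => cell_sub_unit_one _ z⟩
  obtain ⟨u, hu, hu'⟩ := hx
  obtain ⟨w, hw, hw'⟩ := hy
  rcases h4 with ⟨rfl, rfl⟩ | ⟨rfl, rfl⟩
  · exact ⟨0, 1, u, w, by decide, hu, hw, (hu' d.2).symm, (hw' d.1).symm, by
      rw [hu' d.2, hw']⟩
  · exact ⟨1, 0, w, u, by decide, hw, hu, (hw' d.1).symm, (hu' d.2).symm, by
      rw [hw' d.1, hu']⟩

theorem Nbr.symm {v w : ℤ × ℤ} (h : Nbr v w) : Nbr w v := by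
  simp only [Nbr] at *; omega

theorem Nbr.exists_unit {v w : ℤ × ℤ} (h : Nbr v w) :
    ∃ i : Fin 3, i ≠ 2 ∧ ∃ u : Cell, (u = unit i ∨ u = -unit i) ∧ ∀ z, cell w z = cell v z + u := by
  obtain ⟨wx, wy⟩ := w
  rcases h with ⟨h1, h2⟩ | ⟨h1, h2⟩ | ⟨h1, h2⟩ | ⟨h1, h2⟩ <;> simp only at h1 h2 <;> subst h1 h2
  · exact ⟨0, by decide, _, Or.inl rfl, fun z => (cell_add_unit_zero v z).symm⟩
  · exact ⟨0, by decide, _, Or.inr rfl, fun z => (cell_sub_unit_zero v z).symm⟩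
  · exact ⟨1, by decide, _, Or.inl rfl, fun z => (cell_add_unit_one v z).symm⟩
  · exact ⟨1, by decide, _, Or.inr rfl, fun z => (cell_sub_unit_one v z).symm⟩

theorem Nbr.isRect {v w : ℤ × ℤ} (h : Nbr v w) :
    IsRect (cell v 0) (cell w 0) (cell v 1) (cell w 1) := by
  obtain ⟨i, hi, u, hu, hw⟩ := h.exists_unit
  refine ⟨i, 2, u, unit 2, hi, hu, Or.inl rfl, hw 0, (cell_add_unit_two v 0).symm, ?_⟩
  rw [← hw 0, cell_add_unit_two w 0]; rfl

theorem Sq.nbr {d c a b : ℤ × ℤ} (h : Sq d c a b) : Nbr d c := by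
  obtain ⟨ε, δ, h1, h2, -, h4⟩ := h
  rcases h4 with ⟨rfl, -⟩ | ⟨rfl, -⟩ <;> rcases h1 with rfl | rfl <;> rcases h2 with rfl | rfl <;>
    simp [Nbr, sub_eq_add_neg]

theorem pair_cell_eq {v w v' w' : ℤ × ℤ} {z z' : ℤ}
    (h : ({cell v z, cell w z} : Finset Cell) = {cell v' z', cell w' z'}) :
    z = z' ∧ ((v = v' ∧ w = w') ∨ (v = w' ∧ w = v')) := by
  rcases pair_eq_pair h with ⟨h1, h2⟩ | ⟨h1, h2⟩ <;> rw [cell_inj] at h1 h2 <;> tauto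

theorem not_isJewel (v w : ℤ × ℤ) (z : ℤ) : ¬ IsJewel {cell v z, cell w z} := by
  rintro ⟨u, h⟩
  rcases pair_eq_pair h with ⟨h1, h2⟩ | ⟨h1, h2⟩ <;> rw [cell_inj] at h1 h2 <;> omega

theorem isJewel (v : ℤ × ℤ) : IsJewel {cell v 0, cell v 1} := ⟨v, rfl⟩

/-- A pair of dimers, one above the other, can be flipped to two vertical dimers. -/
theorem exists_more_jewels_of_trivial (t : Tiling R) {v w : ℤ × ℤ} (h : Nbr v w)
    (h0 : {cell v 0, cell w 0} ∈ t.dimers) (h1 : {cell v 1, cell w 1} ∈ t.dimers) :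
    ∃ t' : Tiling R, Move t t' ∧ jewels t < jewels t' := by
  classical
  obtain ⟨t', hm, hs⟩ := canFlip t h.isRect h0 h1
  refine ⟨t', hm, ?_⟩
  have := hs.jewels
  have hA : Finset.filter IsJewel {{cell v 0, cell w 0}, {cell v 1, cell w 1}} = ∅ := by
    simp [Finset.filter_eq_empty_iff, not_isJewel]
  have hB : (Finset.filter IsJewel
      {({cell v 0, cell v 1} : Finset Cell), {cell w 0, cell w 1}}).Nonempty :=
    ⟨_, Finset.mem_filter.mpr ⟨Finset.mem_insert_self _ _, isJewel v⟩⟩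
  rw [hA, Finset.card_empty] at this
  have := hB.card_pos
  omega

/-! ### Trits and moves at a corner -/

/-- Three dimers, no two of them parallel, covering six cubes of a `2 × 2 × 2` cube. -/
def tritDimers (d c a b : ℤ × ℤ) (z z' : ℤ) : Finset (Finset Cell) :=
  {{cell d z, cell c z}, {cell d z', cell a z'}, {cell b 0, cell b 1}}

theorem mem_tritDimers {d c a b : ℤ × ℤ} {z z' : ℤ} {e : Finset Cell} :
    e ∈ tritDimers d c a b z z' ↔
      e = {cell d z, cell c z} ∨ e = {cell d z', cell a z'} ∨ e = {cell b 0, cell b 1} := by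
  simp [tritDimers]

/-- The two floors, in some order. -/
def Floors (z z' : ℤ) : Prop := (z = 0 ∧ z' = 1) ∨ (z = 1 ∧ z' = 0)

theorem Sq.ne {d c a b : ℤ × ℤ} (h : Sq d c a b) :
    d ≠ c ∧ d ≠ a ∧ d ≠ b ∧ c ≠ a ∧ c ≠ b ∧ a ≠ b := by
  obtain ⟨dx, dy⟩ := d
  obtain ⟨ε, δ, h1, h2, rfl, h4⟩ := h
  simp only
  rcases h4 with ⟨rfl, rfl⟩ | ⟨rfl, rfl⟩ <;> simp only [ne_eq, Prod.mk.injEq] <;> omega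

theorem Sq.tritDimers_disjoint {d c a b : ℤ × ℤ} (h : Sq d c a b) {z z' : ℤ} (hz : Floors z z') :
    ∀ e ∈ tritDimers d c a b z z', ∀ f ∈ tritDimers d c a b z z', e ≠ f → Disjoint e f := by
  obtain ⟨h1, h2, h3, h4, h5, h6⟩ := h.ne
  have e1 : Disjoint ({cell d z, cell c z} : Finset Cell) {cell d z', cell a z'} := by
    rcases hz with ⟨rfl, rfl⟩ | ⟨rfl, rfl⟩ <;> simp [cell_inj]
  have e2 : Disjoint ({cell d z, cell c z} : Finset Cell) {cell b 0, cell b 1} := by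
    simp [cell_inj, h3.symm, h5.symm]
  have e3 : Disjoint ({cell d z', cell a z'} : Finset Cell) {cell b 0, cell b 1} := by
    simp [cell_inj, h3.symm, h6.symm]
  intro e he f hf hne
  rcases mem_tritDimers.mp he with rfl | rfl | rfl <;>
    rcases mem_tritDimers.mp hf with rfl | rfl | rfl <;>
    first
      | exact absurd rfl hne
      | assumption
      | exact Disjoint.symm (by assumption)

theorem card_tritDimers {d c a b : ℤ × ℤ} {z z' : ℤ} (hz : Floors z z') :
    (tritDimers d c a b z z').card = 3 := by
  rw [tritDimers, Finset.card_eq_three]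
  refine ⟨_, _, _, ?_, ?_, ?_, rfl⟩
  · intro h'
    have := (pair_cell_eq h').1
    rcases hz with ⟨rfl, rfl⟩ | ⟨rfl, rfl⟩ <;> omega
  · exact fun h' => not_isJewel d c z (h' ▸ isJewel b)
  · exact fun h' => not_isJewel d a z' (h' ▸ isJewel b)

theorem isDimerAlong_two (v : ℤ × ℤ) : IsDimerAlong 2 {cell v 0, cell v 1} :=
  ⟨cell v 0, by rw [cell_add_unit_two]; rfl⟩

theorem isDimerAlong_zero (x ε y z : ℤ) (h : ε = 1 ∨ ε = -1) :
    IsDimerAlong 0 {cell (x, y) z, cell (x + ε, y) z} := by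
  rcases h with rfl | rfl
  · exact ⟨cell (x, y) z, by rw [cell_add_unit_zero]⟩
  · exact ⟨cell (x + -1, y) z, by rw [cell_add_unit_zero, Finset.pair_comm]; simp⟩

theorem isDimerAlong_one (x y δ z : ℤ) (h : δ = 1 ∨ δ = -1) :
    IsDimerAlong 1 {cell (x, y) z, cell (x, y + δ) z} := by
  rcases h with rfl | rfl
  · exact ⟨cell (x, y) z, by rw [cell_add_unit_one]⟩
  · exact ⟨cell (x, y + -1) z, by rw [cell_add_unit_one, Finset.pair_comm]; simp⟩

theorem Sq.tritDimers_along {d c a b : ℤ × ℤ} (h : Sq d c a b) (z z' : ℤ) :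
    ((IsDimerAlong 0 {cell d z, cell c z} ∧ IsDimerAlong 1 {cell d z', cell a z'}) ∨
      (IsDimerAlong 1 {cell d z, cell c z} ∧ IsDimerAlong 0 {cell d z', cell a z'})) := by
  obtain ⟨ε, δ, h1, h2, -, h4⟩ := h
  rcases h4 with ⟨rfl, rfl⟩ | ⟨rfl, rfl⟩
  · exact Or.inl ⟨isDimerAlong_zero _ _ _ _ h1, isDimerAlong_one _ _ _ _ h2⟩
  · exact Or.inr ⟨isDimerAlong_one _ _ _ _ h2, isDimerAlong_zero _ _ _ _ h1⟩

theorem Sq.isDimer_tritDimers {d c a b : ℤ × ℤ} (h : Sq d c a b) (z z' : ℤ) :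
    ∀ e ∈ tritDimers d c a b z z', IsDimer e := by
  intro e he
  rcases mem_tritDimers.mp he with rfl | rfl | rfl
  · rcases h.tritDimers_along z z' with h | h
    exacts [⟨_, h.1⟩, ⟨_, h.1⟩]
  · rcases h.tritDimers_along z z' with h | h
    exacts [⟨_, h.2⟩, ⟨_, h.2⟩]
  · exact ⟨2, isDimerAlong_two b⟩

theorem Sq.exists_along_tritDimers {d c a b : ℤ × ℤ} (h : Sq d c a b) (z z' : ℤ) (i : Fin 3) :
    ∃ e ∈ tritDimers d c a b z z', IsDimerAlong i e := by
  have m1 : {cell d z, cell c z} ∈ tritDimers d c a b z z' := mem_tritDimers.mpr (by simp)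
  have m2 : {cell d z', cell a z'} ∈ tritDimers d c a b z z' := mem_tritDimers.mpr (by simp)
  have m3 : {cell b 0, cell b 1} ∈ tritDimers d c a b z z' := mem_tritDimers.mpr (by simp)
  fin_cases i
  · rcases h.tritDimers_along z z' with h | h
    exacts [⟨_, m1, h.1⟩, ⟨_, m2, h.2⟩]
  · rcases h.tritDimers_along z z' with h | h
    exacts [⟨_, m2, h.2⟩, ⟨_, m1, h.1⟩]
  · exact ⟨_, m3, isDimerAlong_two b⟩

theorem Sq.tritDimers_bounds {d c a b : ℤ × ℤ} (h : Sq d c a b) {z z' : ℤ} (hz : Floors z z') :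
    ∀ e ∈ tritDimers d c a b z z', ∀ p ∈ e, ∀ k,
      cell (min d.1 b.1, min d.2 b.2) 0 k ≤ p k ∧ p k ≤ cell (min d.1 b.1, min d.2 b.2) 0 k + 1 := by
  have key : ∀ v : ℤ × ℤ, (v = d ∨ v = c ∨ v = a ∨ v = b) → ∀ z, (z = 0 ∨ z = 1) → ∀ k,
      cell (min d.1 b.1, min d.2 b.2) 0 k ≤ cell v z k ∧
        cell v z k ≤ cell (min d.1 b.1, min d.2 b.2) 0 k + 1 := by
    obtain ⟨dx, dy⟩ := d
    obtain ⟨ε, δ, h1, h2, rfl, h4⟩ := h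
    intro v hv z hz k
    have : (v.1 = dx ∨ v.1 = dx + ε) ∧ (v.2 = dy ∨ v.2 = dy + δ) := by
      rcases h4 with ⟨rfl, rfl⟩ | ⟨rfl, rfl⟩ <;> rcases hv with rfl | rfl | rfl | rfl <;> simp
    fin_cases k <;> simp [cell] <;> omega
  intro e he p hp
  have hz0 : z = 0 ∨ z = 1 := by unfold Floors at hz; omega
  have hz1 : z' = 0 ∨ z' = 1 := by unfold Floors at hz; omega
  rcases mem_tritDimers.mp he with rfl | rfl | rfl <;>
    simp only [Finset.mem_insert, Finset.mem_singleton] at hp <;> rcases hp with rfl | rfl <;>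
    apply key <;> simp [hz0, hz1]

/-- Both triples omit exactly `c` on floor `z'` and `a` on floor `z` from the eight cubes. -/
theorem tritDimers_biUnion (d c a b : ℤ × ℤ) {z z' : ℤ} (hz : Floors z z') :
    (tritDimers b c a d z z').biUnion id = (tritDimers d c a b z z').biUnion id := by
  ext p
  rcases hz with ⟨rfl, rfl⟩ | ⟨rfl, rfl⟩ <;> simp [tritDimers] <;> tauto

theorem Sq.tritDimers_ne {d c a b : ℤ × ℤ} (h : Sq d c a b) (z z' : ℤ) :
    tritDimers b c a d z z' ≠ tritDimers d c a b z z' := by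
  intro h'
  have hm : {cell d 0, cell d 1} ∈ tritDimers b c a d z z' := mem_tritDimers.mpr (by simp)
  rw [h'] at hm
  rcases mem_tritDimers.mp hm with h1 | h1 | h1
  · exact not_isJewel _ _ _ (h1 ▸ isJewel d)
  · exact not_isJewel _ _ _ (h1 ▸ isJewel d)
  · have : cell d 0 ∈ ({cell b 0, cell b 1} : Finset Cell) := h1 ▸ Finset.mem_insert_self _ _
    simp only [Finset.mem_insert, Finset.mem_singleton, cell_inj] at this
    have := h.ne.2.2.1
    tauto

theorem isTrit_of_sq {t t' : Tiling R} {d c a b : ℤ × ℤ} {z z' : ℤ} (h : Sq d c a b)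
    (hz : Floors z z') (hA : tritDimers d c a b z z' ⊆ t.dimers)
    (ht : t'.dimers = t.dimers \ tritDimers d c a b z z' ∪ tritDimers b c a d z z') :
    IsTrit t t' :=
  ⟨cell (min d.1 b.1, min d.2 b.2) 0, _, _, hA, card_tritDimers hz,
    h.exists_along_tritDimers z z', h.tritDimers_bounds hz, tritDimers_biUnion d c a b hz,
    h.tritDimers_ne z z', ht⟩

theorem card_filter_tritDimers (d c a b : ℤ × ℤ) (z z' : ℤ) [DecidablePred IsJewel] :
    ((tritDimers d c a b z z').filter IsJewel).card = 1 := by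
  rw [Finset.card_eq_one]
  refine ⟨{cell b 0, cell b 1}, ?_⟩
  ext e
  simp only [Finset.mem_filter, mem_tritDimers, Finset.mem_singleton]
  constructor
  · rintro ⟨rfl | rfl | rfl, h⟩
    · exact absurd h (not_isJewel _ _ _)
    · exact absurd h (not_isJewel _ _ _)
    · rfl
  · rintro rfl
    exact ⟨by simp, isJewel b⟩

/-- A corner of a cycle with a vertical dimer at the opposite vertex can be cut by a trit. -/
theorem exists_trit (t : Tiling R) {d c a b : ℤ × ℤ} {z z' : ℤ} (h : Sq d c a b)
    (hz : Floors z z') (h1 : {cell d z, cell c z} ∈ t.dimers)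
    (h2 : {cell d z', cell a z'} ∈ t.dimers) (h3 : {cell b 0, cell b 1} ∈ t.dimers) :
    ∃ t' : Tiling R, Move t t' ∧ jewels t' = jewels t ∧
      Swap t t' (tritDimers d c a b z z') (tritDimers b c a d z z') := by
  classical
  obtain ⟨t', hs⟩ := t.exists_swap (tritDimers d c a b z z') (tritDimers b c a d z z')
    (by intro e he; rcases mem_tritDimers.mp he with rfl | rfl | rfl <;> assumption)
    (h.opposite.isDimer_tritDimers z z') (h.opposite.tritDimers_disjoint hz)
    (tritDimers_biUnion d c a b hz)
  refine ⟨t', ⟨Or.inr (isTrit_of_sq h hz hs.subset hs.dimers_eq),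
    Or.inr (isTrit_of_sq h.opposite hz hs.subset' hs.dimers_eq')⟩, ?_, hs⟩
  have := hs.jewels
  rw [card_filter_tritDimers, card_filter_tritDimers] at this
  omega

/-- A corner of a cycle which is thin there can be flipped away. -/
theorem exists_more_jewels_of_thin (t : Tiling R) {d c a b : ℤ × ℤ} {z z' : ℤ} (h : Sq d c a b)
    (hz : Floors z z') (h1 : {cell d z, cell c z} ∈ t.dimers)
    (h2 : {cell d z', cell a z'} ∈ t.dimers) (h3 : {cell c z', cell b z'} ∈ t.dimers) :
    ∃ t' : Tiling R, Relation.ReflTransGen Move t t' ∧ jewels t < jewels t' := by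
  classical
  -- Flipping `da`, `cb` to `dc`, `ab` on floor `z'` makes `dc` a doubled edge.
  obtain ⟨t', hm, hs⟩ := canFlip t (h.swap.isRect z') h2 h3
  have hj := hs.jewels
  have e1 : ∀ p q r s : ℤ × ℤ, Finset.filter IsJewel
      {({cell p z', cell q z'} : Finset Cell), {cell r z', cell s z'}} = ∅ := by
    intro p q r s
    simp [Finset.filter_eq_empty_iff, not_isJewel]
  rw [e1, e1] at hj
  have m1 : {cell d z, cell c z} ∈ t'.dimers := by
    rw [hs.dimers_eq]
    refine Finset.mem_union_left _ (Finset.mem_sdiff.mpr ⟨h1, fun h' => ?_⟩)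
    have hzz : z ≠ z' := by unfold Floors at hz; omega
    simp only [Finset.mem_insert, Finset.mem_singleton] at h'
    rcases h' with h' | h' <;> exact hzz (pair_cell_eq h').1
  have m2 : {cell d z', cell c z'} ∈ t'.dimers := hs.subset' (Finset.mem_insert_self _ _)
  obtain ⟨t'', hm', hj'⟩ : ∃ t'' : Tiling R, Move t' t'' ∧ jewels t' < jewels t'' := by
    rcases hz with ⟨rfl, rfl⟩ | ⟨rfl, rfl⟩
    · exact exists_more_jewels_of_trivial t' h.nbr m1 m2
    · exact exists_more_jewels_of_trivial t' h.nbr m2 m1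
  exact ⟨t'', (Relation.ReflTransGen.single hm).tail hm', by omega⟩

/-! ### The shadow and the height of a tiling -/

/-- The common shadow of the two floors. -/
def shadow (R : Finset Cell) : Finset (ℤ × ℤ) := (floor R 0).image fun c => (c 0, c 1)

theorem cell_eta (c : Cell) : cell (c 0, c 1) (c 2) = c := by
  ext i; fin_cases i <;> rfl

theorem mem_shadow {v : ℤ × ℤ} : v ∈ shadow R ↔ cell v 0 ∈ R := by
  simp only [shadow, floor, Finset.mem_image, Finset.mem_filter]
  constructor
  · rintro ⟨c, ⟨hc, h2⟩, rfl⟩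
    rwa [← h2, cell_eta]
  · intro h
    exact ⟨cell v 0, ⟨h, rfl⟩, rfl⟩

theorem IsDuplex.cell_mem_iff (hR : IsDuplex R) {v : ℤ × ℤ} {z : ℤ} :
    cell v z ∈ R ↔ v ∈ shadow R ∧ (z = 0 ∨ z = 1) := by
  constructor
  · intro h
    have hz := (hR.nonempty_iff z).mp ⟨cell v z, Finset.mem_filter.mpr ⟨h, rfl⟩⟩
    refine ⟨mem_shadow.mpr ?_, hz⟩
    rcases hz with rfl | rfl
    · exact h
    · exact (hR.identical v.1 v.2).mpr h
  · rintro ⟨h, rfl | rfl⟩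
    · exact mem_shadow.mp h
    · exact (hR.identical v.1 v.2).mp (mem_shadow.mp h)

theorem IsDuplex.holeFree_shadow (hR : IsDuplex R) : HoleFree (shadow R) := by
  apply holeFree_of_isSimplyConnected
  have : (shadow R).image (fun v => cell v 0) = floor R 0 := by
    ext c
    simp only [Finset.mem_image, mem_shadow, floor, Finset.mem_filter]
    constructor
    · rintro ⟨v, hv, rfl⟩
      exact ⟨hv, rfl⟩
    · rintro ⟨hc, h2⟩
      have := cell_eta c
      rw [h2] at this
      exact ⟨_, by rwa [this], this⟩
  rw [this]
  exact hR.simplyConnected 0 (Or.inl rfl)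

theorem Tiling.cell_mem (t : Tiling R) {p q : Cell} (h : {p, q} ∈ t.dimers) : p ∈ R :=
  t.subset h (Finset.mem_insert_self _ _)

/-- A cell of the shadow carries a vertical dimer or one horizontal dimer on each floor. -/
theorem IsDuplex.jewel_or_horizontal (hR : IsDuplex R) (t : Tiling R) {v : ℤ × ℤ}
    (hv : v ∈ shadow R) : {cell v 0, cell v 1} ∈ t.dimers ∨
      ∀ z, (z = 0 ∨ z = 1) → ∃ w, Nbr v w ∧ {cell v z, cell w z} ∈ t.dimers := by
  by_contra! hcon
  obtain ⟨hJ, z, hz, hno⟩ := hcon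
  obtain ⟨q, hq⟩ := t.exists_partner (hR.cell_mem_iff.mpr ⟨hv, hz⟩)
  have hqR : q ∈ R := t.cell_mem (p := q) (q := cell v z) (by rwa [Finset.pair_comm])
  obtain ⟨i, hi⟩ := isDimer_pair.mp (t.isDimer _ hq)
  have hi' : q = cell v z + unit i ∨ q = cell v z + -unit i :=
    hi.imp_right fun h => by rw [h]; abel
  clear hi
  obtain ⟨vx, vy⟩ := v
  have h2 : ∀ y, q = cell (vx, vy) y → y ≠ z → False := by
    rintro y rfl hyz
    have hy := (hR.cell_mem_iff.mp hqR).2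
    apply hJ
    rcases hz with rfl | rfl <;> rcases hy with rfl | rfl
    · omega
    · exact hq
    · rwa [Finset.pair_comm]
    · omega
  fin_cases i
  · simp only [Fin.zero_eta, cell_add_unit_zero, cell_sub_unit_zero] at hi'
    rcases hi' with rfl | rfl
    · exact hno _ (by simp [Nbr]) hq
    · exact hno _ (by simp [Nbr]) hq
  · simp only [Fin.mk_one, cell_add_unit_one, cell_sub_unit_one] at hi'
    rcases hi' with rfl | rfl
    · exact hno _ (by simp [Nbr]) hq
    · exact hno _ (by simp [Nbr]) hq
  · rcases hi' with h | h
    · exact h2 (z + 1) (h.trans (cell_add_unit_two _ _)) (by omega)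
    · refine h2 (z - 1) (h.trans ?_) (by omega)
      rw [← sub_eq_add_neg, sub_eq_iff_eq_add]
      exact (by simpa using (cell_add_unit_two (vx, vy) (z - 1)).symm)

open Classical in
/-- The indicator, modulo two, of a horizontal dimer. -/
noncomputable def ind (t : Tiling R) (z : ℤ) (v w : ℤ × ℤ) : ZMod 2 :=
  if {cell v z, cell w z} ∈ t.dimers then 1 else 0

theorem ind_comm (t : Tiling R) (z : ℤ) (v w : ℤ × ℤ) : ind t z v w = ind t z w v := by
  simp only [ind, Finset.pair_comm]

theorem ind_eq_zero_of_notMem (hR : IsDuplex R) (t : Tiling R) (z : ℤ) {v : ℤ × ℤ}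
    (hv : v ∉ shadow R) (w : ℤ × ℤ) : ind t z v w = 0 :=
  if_neg fun h => hv (hR.cell_mem_iff.mp (t.cell_mem h)).1

-- The degree on one floor does not depend on the floor, so superimposing the two floors gives even
-- degrees.
open Classical in
theorem sum_ind (hR : IsDuplex R) (t : Tiling R) (z : ℤ) (hz : z = 0 ∨ z = 1) (x y : ℤ) :
    ind t z (x, y) (x + 1, y) + ind t z (x, y) (x - 1, y) + ind t z (x, y) (x, y + 1) +
      ind t z (x, y) (x, y - 1) =
      if (x, y) ∈ shadow R ∧ {cell (x, y) 0, cell (x, y) 1} ∉ t.dimers then 1 else 0 := by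
  by_cases hv : (x, y) ∈ shadow R
  swap
  · rw [if_neg fun h => hv h.1]
    simp [ind_eq_zero_of_notMem hR t z hv]
  by_cases hJ : {cell (x, y) 0, cell (x, y) 1} ∈ t.dimers
  · rw [if_neg fun h => h.2 hJ]
    have : ∀ w, ind t z (x, y) w = 0 := by
      intro w
      refine if_neg fun h => ?_
      rcases hz with rfl | rfl
      · have := (cell_inj.mp (t.partner_unique h hJ)).2
        omega
      · rw [Finset.pair_comm (cell (x, y) 0)] at hJ
        have := (cell_inj.mp (t.partner_unique h hJ)).2
        omega
    simp [this]
  · rw [if_pos ⟨hv, hJ⟩]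
    obtain ⟨w, hw, hwt⟩ := ((hR.jewel_or_horizontal t hv).resolve_left hJ) z hz
    have key : ∀ u, ind t z (x, y) u = if u = w then 1 else 0 := by
      intro u
      by_cases hu : u = w
      · rw [if_pos hu, ind, hu, if_pos hwt]
      · rw [if_neg hu, ind, if_neg]
        exact fun h => hu (cell_inj.mp (t.partner_unique h hwt)).1
    simp only [key]
    obtain ⟨wx, wy⟩ := w
    rcases hw with ⟨h1, h2⟩ | ⟨h1, h2⟩ | ⟨h1, h2⟩ | ⟨h1, h2⟩ <;> simp only at h1 h2 <;> subst h1 h2 <;>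
      simp [Prod.mk.injEq, sub_eq_add_neg]

/-- `vw` is the common side of the neighbouring faces `f` and `g`. -/
def Between (f g v w : ℤ × ℤ) : Prop :=
  Nbr f g ∧ ((v = (max f.1 g.1, max f.2 g.2) ∧ w = (min f.1 g.1 + 1, min f.2 g.2 + 1)) ∨
    (w = (max f.1 g.1, max f.2 g.2) ∧ v = (min f.1 g.1 + 1, min f.2 g.2 + 1)))

/-- A form free of maxima and minima, suited to `omega`. -/
theorem between_iff {f g v w : ℤ × ℤ} : Between f g v w ↔
    (g.2 = f.2 ∧ w.1 = v.1 ∧ (g.1 = f.1 + 1 ∧ v.1 = f.1 + 1 ∨ g.1 = f.1 - 1 ∧ v.1 = f.1) ∧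
      (v.2 = f.2 ∧ w.2 = f.2 + 1 ∨ w.2 = f.2 ∧ v.2 = f.2 + 1)) ∨
    (g.1 = f.1 ∧ w.2 = v.2 ∧ (g.2 = f.2 + 1 ∧ v.2 = f.2 + 1 ∨ g.2 = f.2 - 1 ∧ v.2 = f.2) ∧
      (v.1 = f.1 ∧ w.1 = f.1 + 1 ∨ w.1 = f.1 ∧ v.1 = f.1 + 1)) := by
  obtain ⟨vx, vy⟩ := v
  obtain ⟨wx, wy⟩ := w
  simp only [Between, Nbr, Prod.mk.injEq]
  constructor
  · rintro ⟨⟨h1, h2⟩ | ⟨h1, h2⟩ | ⟨h1, h2⟩ | ⟨h1, h2⟩, ⟨⟨h3, h4⟩, h5, h6⟩ | ⟨⟨h3, h4⟩, h5, h6⟩⟩ <;>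
      omega
  · rintro (⟨h1, h2, ⟨h3, h4⟩ | ⟨h3, h4⟩, ⟨h5, h6⟩ | ⟨h5, h6⟩⟩ |
      ⟨h1, h2, ⟨h3, h4⟩ | ⟨h3, h4⟩, ⟨h5, h6⟩ | ⟨h5, h6⟩⟩) <;>
      exact ⟨by omega, by omega⟩

/-- The edge `vw` is used on exactly one of the two floors. -/
def Crossed (t : Tiling R) (v w : ℤ × ℤ) : Prop :=
  ¬ ({cell v 0, cell w 0} ∈ t.dimers ↔ {cell v 1, cell w 1} ∈ t.dimers)

theorem Crossed.comm {t : Tiling R} {v w : ℤ × ℤ} : Crossed t v w ↔ Crossed t w v := by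
  simp only [Crossed, Finset.pair_comm]

theorem ind_add_ind (t : Tiling R) (v w : ℤ × ℤ) :
    ind t 0 v w + ind t 1 v w = 0 ↔ ¬ Crossed t v w := by
  simp only [ind, Crossed]
  split_ifs with h1 h2 h2 <;> simp [h1, h2, zmod2_add_self]

/-- The height function of a tiling, modulo two. -/
theorem exists_tiling_height (hR : IsDuplex R) (t : Tiling R) :
    ∃ (h : ℤ × ℤ → ZMod 2) (B : Finset (ℤ × ℤ)), (∀ v, v ∉ B → h v = 0) ∧
      ∀ f g v w, Between f g v w → (h f = h g ↔ ¬ Crossed t v w) := by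
  obtain ⟨h, B, hB, h1, h2⟩ := exists_height
    (fun v => ind t 0 v (v.1 + 1, v.2) + ind t 1 v (v.1 + 1, v.2))
    (fun v => ind t 0 v (v.1, v.2 + 1) + ind t 1 v (v.1, v.2 + 1)) (shadow R)
    (fun v hv => by simp [ind_eq_zero_of_notMem hR t _ hv])
    (fun v hv => by simp [ind_eq_zero_of_notMem hR t _ hv]) (by
      intro x y
      have e0 := sum_ind hR t 0 (by simp) x y
      have e1 := sum_ind hR t 1 (by simp) x y
      rw [← e0, ind_comm t 0 (x, y) (x - 1, y), ind_comm t 0 (x, y) (x, y - 1),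
        ind_comm t 1 (x, y) (x - 1, y), ind_comm t 1 (x, y) (x, y - 1)] at e1
      simp only [sub_add_cancel]
      have := CharTwo.add_eq_zero.mpr e1
      linear_combination this)
  refine ⟨h, B, hB, ?_⟩
  have key : ∀ x y x' y', ((x = x' ∧ y = y' + 1) ∨ (x = x' + 1 ∧ y = y')) → ∀ v w,
      Between (x, y) (x', y') v w → (h (x, y) = h (x', y') ↔ ¬ Crossed t v w) := by
    intro x y x' y' hxy v w hvw
    wlog hv : v = (max x x', max y y') ∧ w = (min x x' + 1, min y y' + 1) generalizing v w
    · rw [Crossed.comm]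
      exact this w v ⟨hvw.1, hvw.2.symm⟩ (hvw.2.resolve_left hv)
    rw [← CharTwo.add_eq_zero, ← ind_add_ind]
    obtain ⟨rfl, rfl⟩ := hv
    rcases hxy with ⟨rfl, rfl⟩ | ⟨rfl, rfl⟩
    · have := h1 x (y' + 1)
      rw [add_sub_cancel_right] at this
      rw [this]
      simp
    · have := h2 (x' + 1) y
      rw [add_sub_cancel_right] at this
      rw [this]
      simp
  rintro ⟨x, y⟩ ⟨x', y'⟩ v w hvw
  by_cases hxy : (x = x' ∧ y = y' + 1) ∨ (x = x' + 1 ∧ y = y')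
  · exact key x y x' y' hxy v w hvw
  · rw [eq_comm]
    refine key x' y' x y ?_ v w ⟨hvw.1.symm, ?_⟩
    · have := hvw.1
      simp only [Nbr] at this
      omega
    · have := hvw.2
      simp only at this ⊢
      rwa [max_comm x', max_comm y', min_comm x', min_comm y']

/-! ### Closed sets of faces -/

/-- A set of faces bounded by crossed edges, without crossed edges in its interior. -/
def Closed (t : Tiling R) (Q : Finset (ℤ × ℤ)) : Prop :=
  ∀ f ∈ Q, ∀ g v w, Between f g v w → (g ∈ Q ↔ ¬ Crossed t v w)

theorem not_crossed_of_notMem (hR : IsDuplex R) (t : Tiling R) {v : ℤ × ℤ} (hv : v ∉ shadow R)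
    (w : ℤ × ℤ) : ¬ Crossed t v w := by
  rw [← ind_add_ind]
  simp [ind_eq_zero_of_notMem hR t _ hv]

/-- Every corner of a face of a closed set of faces lies in the region. -/
theorem Closed.mem_shadow (hR : IsDuplex R) {t : Tiling R} {Q : Finset (ℤ × ℤ)} (hQ : Closed t Q)
    {x y vx vy : ℤ} (hf : (x, y) ∈ Q) (hx : vx = x ∨ vx = x + 1) (hy : vy = y ∨ vy = y + 1) :
    (vx, vy) ∈ shadow R := by
  classical
  have key : ∀ x y, (x, y) ∉ shadow R → ∀ f g w, Between f g (x, y) w → f ∈ Q → g ∈ Q :=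
    fun x y hv f g w hb hf => (hQ f hf g _ w hb).mpr (not_crossed_of_notMem hR t hv w)
  -- No crossed edge meets a vertex outside the shadow, so the four faces around it are all in `Q`
  -- or all outside.
  have all : ∀ x y, (x, y) ∉ shadow R → ∀ f, (f.1 = x ∨ f.1 = x - 1) → (f.2 = y ∨ f.2 = y - 1) →
      f ∈ Q → ∀ g, (g.1 = x ∨ g.1 = x - 1) → (g.2 = y ∨ g.2 = y - 1) → g ∈ Q := by
    intro x y hv
    have hx : ∀ b, (b = y ∨ b = y - 1) → ((x, b) ∈ Q ↔ (x - 1, b) ∈ Q) := by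
      intro b hb
      constructor
      -- The far end of the edge between the two faces: `(x, y + 1)` for `b = y` and `(x, y - 1)`
      -- for `b = y - 1`.
      · refine key x y hv _ _ (x, 2 * b + 1 - y) ?_
        rw [between_iff]; omega
      · refine key x y hv _ _ (x, 2 * b + 1 - y) ?_
        rw [between_iff]; omega
    have hy : ∀ a, (a = x ∨ a = x - 1) → ((a, y) ∈ Q ↔ (a, y - 1) ∈ Q) := by
      intro a ha
      constructor
      · refine key x y hv _ _ (2 * a + 1 - x, y) ?_
        rw [between_iff]; omega
      · refine key x y hv _ _ (2 * a + 1 - x, y) ?_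
        rw [between_iff]; omega
    have h1 := hx y (by simp)
    have h2 := hx (y - 1) (by simp)
    have h3 := hy x (by simp)
    rintro ⟨fx, fy⟩ hfx hfy hf ⟨gx, gy⟩ hgx hgy
    simp only at hfx hfy hgx hgy
    rcases hfx with rfl | rfl <;> rcases hfy with rfl | rfl <;> rcases hgx with rfl | rfl <;>
      rcases hgy with rfl | rfl <;> tauto
  have hU := hR.holeFree_shadow (Q.filter (· ∉ shadow R)) (by simp) (by
    rintro ⟨x, y⟩ hu ⟨x', y'⟩ hn
    simp only [Finset.mem_filter] at hu ⊢
    by_cases hv : (x', y') ∈ shadow R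
    · exact Or.inr hv
    refine Or.inl ⟨?_, hv⟩
    simp only [Nbr] at hn
    -- The face named by the coordinatewise minimum touches both neighbouring vertices, so
    -- membership in `Q` passes from one to the other.
    have h1 := all x y hu.2 (x, y) (by simp) (by simp) hu.1 (min x x', min y y')
      (by simp only; omega) (by simp only; omega)
    exact all x' y' hv _ (by simp only; omega) (by simp only; omega) h1 _ (by simp) (by simp))
  by_contra hv
  have := all vx vy hv (x, y) (by simp only; omega) (by simp only; omega) hf (vx, vy) (by simp) (by simp)
  have h' : (vx, vy) ∈ Q.filter (· ∉ shadow R) := Finset.mem_filter.mpr ⟨this, hv⟩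
  rw [hU] at h'
  simp at h'

theorem Between.symm {f g v w : ℤ × ℤ} (h : Between f g v w) : Between f g w v := ⟨h.1, h.2.symm⟩

theorem Between.swap {f g v w : ℤ × ℤ} (h : Between f g v w) : Between g f v w := by
  refine ⟨h.1.symm, ?_⟩
  rw [max_comm g.1, max_comm g.2, min_comm g.1, min_comm g.2]
  exact h.2

/-- An edge has only two adjacent faces. -/
theorem Between.eq_or_eq {f g s s' v w : ℤ × ℤ} (h : Between f g v w) (h' : Between s s' v w) :
    s = f ∨ s = g := by
  obtain ⟨fx, fy⟩ := f
  obtain ⟨gx, gy⟩ := g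
  obtain ⟨sx, sy⟩ := s
  obtain ⟨tx, ty⟩ := s'
  obtain ⟨vx, vy⟩ := v
  obtain ⟨wx, wy⟩ := w
  rw [between_iff] at h h'
  simp only [Prod.mk.injEq] at *
  omega

theorem Between.unique {f g v w v' w' : ℤ × ℤ} (h : Between f g v w) (h' : Between f g v' w') :
    (v = v' ∧ w = w') ∨ (v = w' ∧ w = v') := by
  obtain ⟨-, ⟨rfl, rfl⟩ | ⟨rfl, rfl⟩⟩ := h <;> obtain ⟨-, ⟨rfl, rfl⟩ | ⟨rfl, rfl⟩⟩ := h' <;> simp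

/-- An enclosed set containing `s` would contain `g` too; but without `s` it is enclosed by `Q`,
hence empty. -/
theorem HoleFree.erase {Q : Finset (ℤ × ℤ)} (hQ : HoleFree Q) {s g : ℤ × ℤ} (hs : s ∈ Q)
    (hg : Nbr s g) (hgQ : g ∉ Q) : HoleFree (Q.erase s) := by
  intro U hU hN
  have h1 := hQ (U.erase s) (by
    intro u hu huQ
    rw [Finset.mem_erase] at hu
    exact hU u hu.2 (Finset.mem_erase.mpr ⟨hu.1, huQ⟩)) (by
    intro u hu v hv
    by_cases hvs : v = s
    · exact Or.inr (hvs ▸ hs)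
    · rcases hN u (Finset.mem_erase.mp hu).2 v hv with h | h
      · exact Or.inl (Finset.mem_erase.mpr ⟨hvs, h⟩)
      · exact Or.inr (Finset.mem_erase.mp h).2)
  have hsU : s ∉ U := by
    intro hsU
    have hgs : g ≠ s := fun h => hgQ (h ▸ hs)
    rcases hN s hsU g hg with h | h
    · have : g ∈ U.erase s := Finset.mem_erase.mpr ⟨hgs, h⟩
      rw [h1] at this
      simp at this
    · exact hgQ (Finset.mem_erase.mp h).2
  rwa [Finset.erase_eq_of_notMem hsU] at h1

/-- The four corners of the face `(x, y)`, starting from the one in direction `(ε, δ)`. -/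
theorem exists_corners (x y ε δ : ℤ) (hε : ε = 1 ∨ ε = -1) (hδ : δ = 1 ∨ δ = -1) :
    ∃ d c a b : ℤ × ℤ, Sq d c a b ∧ Between (x, y) (x + ε, y) d a ∧
      Between (x, y) (x, y + δ) d c ∧ Between (x, y) (x - ε, y) c b ∧
      Between (x, y) (x, y - δ) a b ∧ (b.1 = x ∨ b.1 = x + 1) ∧ (b.2 = y ∨ b.2 = y + 1) ∧
      ∀ w, Nbr b w → Between (x, y) (x - ε, y) b w ∨ Between (x, y) (x, y - δ) b w ∨
        Between (x - ε, y) (x - ε, y - δ) b w ∨ Between (x, y - δ) (x - ε, y - δ) b w := by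
  -- The face spans `x` to `x + 1`, so its extreme coordinate in direction `ε` is `x + 1` or `x`,
  -- not `x + ε`.
  obtain ⟨X, hX⟩ : ∃ X, (ε = 1 ∧ X = x + 1) ∨ (ε = -1 ∧ X = x) := by
    rcases hε with rfl | rfl <;> simp
  obtain ⟨Y, hY⟩ : ∃ Y, (δ = 1 ∧ Y = y + 1) ∨ (δ = -1 ∧ Y = y) := by
    rcases hδ with rfl | rfl <;> simp
  refine ⟨(X, Y), (X - ε, Y), (X, Y - δ), (X - ε, Y - δ),
    ⟨-ε, -δ, by omega, by omega, by simp [sub_eq_add_neg], by simp [sub_eq_add_neg]⟩,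
    ?_, ?_, ?_, ?_, ?_, ?_, ?_⟩
  · rw [between_iff]; omega
  · rw [between_iff]; omega
  · rw [between_iff]; omega
  · rw [between_iff]; omega
  · simp only; omega
  · simp only; omega
  · rintro ⟨wx, wy⟩ hw
    have : (wx = X - ε + ε ∧ wy = Y - δ) ∨ (wx = X - ε - ε ∧ wy = Y - δ) ∨
        (wx = X - ε ∧ wy = Y - δ + δ) ∨ (wx = X - ε ∧ wy = Y - δ - δ) := by
      simp only [Nbr] at hw; omega
    rcases this with ⟨rfl, rfl⟩ | ⟨rfl, rfl⟩ | ⟨rfl, rfl⟩ | ⟨rfl, rfl⟩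
    · right; left; rw [between_iff]; omega
    · right; right; left; rw [between_iff]; omega
    · left; rw [between_iff]; omega
    · right; right; right; rw [between_iff]; omega

theorem Crossed.cases {t : Tiling R} {v w : ℤ × ℤ} (h : Crossed t v w) {z z' : ℤ}
    (hz : Floors z z') :
    ({cell v z, cell w z} ∈ t.dimers ∧ {cell v z', cell w z'} ∉ t.dimers) ∨
      ({cell v z', cell w z'} ∈ t.dimers ∧ {cell v z, cell w z} ∉ t.dimers) := by
  unfold Crossed at h
  rcases hz with ⟨rfl, rfl⟩ | ⟨rfl, rfl⟩ <;> tauto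

theorem mem_iff_of_swap {t t' : Tiling R} {A B : Finset (Finset Cell)} (h : Swap t t' A B)
    {e : Finset Cell} (hA : e ∉ A) (hB : e ∉ B) : e ∈ t'.dimers ↔ e ∈ t.dimers := by
  rw [h.dimers_eq, Finset.mem_union, Finset.mem_sdiff]
  tauto

/-- Cutting a corner by a trit removes one face from a closed set of faces. -/
theorem Closed.erase {t t' : Tiling R} {Q : Finset (ℤ × ℤ)} (hQ : Closed t Q)
    {d c a b s g₁ g₂ g₃ g₄ : ℤ × ℤ} {z z' : ℤ} (h : Sq d c a b) (hz : Floors z z')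
    (hs : Swap t t' (tritDimers d c a b z z') (tritDimers b c a d z z'))
    (h1 : Between s g₁ d a) (h2 : Between s g₂ d c) (h3 : Between s g₃ c b) (h4 : Between s g₄ a b)
    (hall : ∀ g, Nbr s g → g = g₁ ∨ g = g₂ ∨ g = g₃ ∨ g = g₄) (hg1 : g₁ ∉ Q) (hg2 : g₂ ∉ Q) : Closed t' (Q.erase s) := by
  have hbc : {cell b z, cell c z} ∈ t'.dimers := hs.subset' (mem_tritDimers.mpr (by simp))
  have hba : {cell b z', cell a z'} ∈ t'.dimers := hs.subset' (mem_tritDimers.mpr (by simp))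
  have hcross : Crossed t' b c ∧ Crossed t' b a := by
    have n1 : {cell b z', cell c z'} ∉ t'.dimers := fun h' =>
      h.ne.2.2.2.1 (cell_inj.mp (t'.partner_unique h' hba)).1
    have n2 : {cell b z, cell a z} ∉ t'.dimers := fun h' =>
      h.ne.2.2.2.1 (cell_inj.mp (t'.partner_unique hbc h')).1
    unfold Crossed
    rcases hz with ⟨rfl, rfl⟩ | ⟨rfl, rfl⟩ <;> tauto
  intro f hf g v w hb
  obtain ⟨hfs, hfQ⟩ := Finset.mem_erase.mp hf
  by_cases hgs : g = s
  · subst hgs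
    have hc : Crossed t' v w := by
      have hb' := hb.swap
      rcases hall f hb'.1 with rfl | rfl | rfl | rfl
      · exact absurd hfQ hg1
      · exact absurd hfQ hg2
      · rcases hb'.unique h3 with ⟨rfl, rfl⟩ | ⟨rfl, rfl⟩
        exacts [Crossed.comm.mp hcross.1, hcross.1]
      · rcases hb'.unique h4 with ⟨rfl, rfl⟩ | ⟨rfl, rfl⟩
        exacts [Crossed.comm.mp hcross.2, hcross.2]
    simp [hc]
  -- An edge between two faces other than `s` is not a side of `s`, so the trit does not affect it.
  · have key : ∀ p q g₀, Between s g₀ p q → ∀ y y' : ℤ,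
        ({cell v y, cell w y} : Finset Cell) ≠ {cell p y', cell q y'} := by
      intro p q g₀ hpq y y' he
      have : Between s g₀ v w := by
        rcases (pair_cell_eq he).2 with ⟨rfl, rfl⟩ | ⟨rfl, rfl⟩
        exacts [hpq, hpq.symm]
      rcases hb.eq_or_eq this with h' | h'
      exacts [hfs h'.symm, hgs h'.symm]
    have hmem : ∀ y, {cell v y, cell w y} ∈ t'.dimers ↔ {cell v y, cell w y} ∈ t.dimers := by
      intro y
      refine mem_iff_of_swap hs (fun he => ?_) (fun he => ?_)
      · rcases mem_tritDimers.mp he with he | he | he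
        · exact key _ _ _ h2 _ _ he
        · exact key _ _ _ h1 _ _ he
        · exact not_isJewel v w y (he ▸ isJewel b)
      · rcases mem_tritDimers.mp he with he | he | he
        · exact key _ _ _ h3.symm _ _ he
        · exact key _ _ _ h4.symm _ _ he
        · exact not_isJewel v w y (he ▸ isJewel d)
    rw [Finset.mem_erase, Crossed, hmem, hmem]
    exact (and_iff_right hgs).trans (hQ f hfQ g v w hb)

/-! ### Increasing the number of vertical dimers -/

/-- A nonempty closed hole-free set of faces yields a tiling with more vertical dimers. -/
theorem exists_more_jewels_of_closed (hR : IsDuplex R) (n : ℕ) :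
    ∀ (t : Tiling R) (Q : Finset (ℤ × ℤ)), Q.card = n → Q.Nonempty → HoleFree Q → Closed t Q →
      ∃ t' : Tiling R, Relation.ReflTransGen Move t t' ∧ jewels t < jewels t' := by
  induction n with
  | zero =>
    intro t Q hn hne
    exact absurd hn hne.card_pos.ne'
  | succ n ih =>
    intro t Q hn hne hQ hcl
    obtain ⟨x, y, ε, δ, hε, hδ, hs, hg1, hg2, hear⟩ := exists_ear Q hQ hne
    obtain ⟨d, c, a, b, hsq, h1, h2, h3, h4, hbx, hby, hb⟩ := exists_corners x y ε δ hε hδ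
    have c1 : Crossed t d a := by_contra fun h => hg1 ((hcl _ hs _ _ _ h1).mpr h)
    have c2 : Crossed t d c := by_contra fun h => hg2 ((hcl _ hs _ _ _ h2).mpr h)
    have hca := hsq.ne.2.2.2.1
    -- Two distinct edges at `d` cannot lie on the same floor.
    obtain ⟨z, z', hz, hdc, hda⟩ : ∃ z z', Floors z z' ∧ {cell d z, cell c z} ∈ t.dimers ∧
        {cell d z', cell a z'} ∈ t.dimers := by
      have hz : Floors 0 1 := Or.inl ⟨rfl, rfl⟩
      have hz' : Floors 1 0 := Or.inr ⟨rfl, rfl⟩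
      rcases c2.cases hz with ⟨e2, -⟩ | ⟨e2, -⟩ <;> rcases c1.cases hz with ⟨e1, -⟩ | ⟨e1, -⟩
      · exact absurd (cell_inj.mp (t.partner_unique e2 e1)).1 hca
      · exact ⟨_, _, hz, e2, e1⟩
      · exact ⟨_, _, hz', e2, e1⟩
      · exact absurd (cell_inj.mp (t.partner_unique e2 e1)).1 hca
    have hdb := hsq.ne.2.2.1
    -- On floor `z` the vertex `c` is already matched to `d`, so a crossed `cb` lies on floor `z'`.
    have thin1 : Crossed t c b →
        ∃ t' : Tiling R, Relation.ReflTransGen Move t t' ∧ jewels t < jewels t' := by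
      intro h
      rcases h.cases hz with ⟨e, -⟩ | ⟨e, -⟩
      · rw [Finset.pair_comm] at hdc
        exact absurd (cell_inj.mp (t.partner_unique hdc e)).1 hdb
      · exact exists_more_jewels_of_thin t hsq hz hdc hda e
    have thin2 : Crossed t a b →
        ∃ t' : Tiling R, Relation.ReflTransGen Move t t' ∧ jewels t < jewels t' := by
      intro h
      rcases h.cases hz with ⟨e, -⟩ | ⟨e, -⟩
      · exact exists_more_jewels_of_thin t hsq.swap (hz.symm.imp And.symm And.symm) hda hdc e
      · rw [Finset.pair_comm] at hda
        exact absurd (cell_inj.mp (t.partner_unique hda e)).1 hdb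
    rcases hear with hg3 | hg4 | ⟨hg3, hg4, hg5⟩
    · exact thin1 (by_contra fun h => hg3 ((hcl _ hs _ _ _ h3).mpr h))
    · exact thin2 (by_contra fun h => hg4 ((hcl _ hs _ _ _ h4).mpr h))
    have hbD : b ∈ shadow R := hcl.mem_shadow hR hs hbx hby
    rcases hR.jewel_or_horizontal t hbD with hJ | hH
    · obtain ⟨t', hm, hj, hsw⟩ := exists_trit t hsq hz hdc hda hJ
      obtain ⟨t'', hm', hj'⟩ := ih t' (Q.erase (x, y))
        (by rw [Finset.card_erase_of_mem hs, hn]; rfl)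
        ⟨_, Finset.mem_erase.mpr ⟨by simp only [ne_eq, Prod.mk.injEq]; omega, hg3⟩⟩
        (hQ.erase hs h1.1 hg1)
        (hcl.erase hsq hz hsw h1 h2 h3 h4 (by
          rintro ⟨gx, gy⟩ hg
          simp only [Nbr, Prod.mk.injEq] at hg ⊢
          omega) hg1 hg2)
      exact ⟨t'', Relation.ReflTransGen.head hm hm', by omega⟩
    · obtain ⟨w, hw, hw0⟩ := hH 0 (by simp)
      -- All four faces around `b` belong to `Q`, so the edge `bw` is not crossed; being used on
      -- floor `0`, it is doubled.
      have hnc : ¬ Crossed t b w := by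
        rcases hb w hw with h | h | h | h
        · exact (hcl _ hs _ _ _ h).mp hg3
        · exact (hcl _ hs _ _ _ h).mp hg4
        · exact (hcl _ hg3 _ _ _ h).mp hg5
        · exact (hcl _ hg4 _ _ _ h).mp hg5
      obtain ⟨t', hm, hj⟩ := exists_more_jewels_of_trivial t hw hw0 ((not_not.mp hnc).mp hw0)
      exact ⟨t', Relation.ReflTransGen.single hm, hj⟩

theorem Nbr.exists_between {v w : ℤ × ℤ} (h : Nbr v w) : ∃ f g, Between f g v w := by
  obtain ⟨vx, vy⟩ := v
  obtain ⟨wx, wy⟩ := w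
  rcases h with ⟨h1, h2⟩ | ⟨h1, h2⟩ | ⟨h1, h2⟩ | ⟨h1, h2⟩ <;> simp only at h1 h2
  · exact ⟨(vx, vy), (vx, vy - 1), by rw [between_iff]; omega⟩
  · exact ⟨(wx, vy), (wx, vy - 1), by rw [between_iff]; omega⟩
  · exact ⟨(vx, vy), (vx - 1, vy), by rw [between_iff]; omega⟩
  · exact ⟨(vx, wy), (vx - 1, wy), by rw [between_iff]; omega⟩

/-- Unless all dimers are vertical, their number can be increased. -/
theorem exists_more_jewels (hR : IsDuplex R) (t : Tiling R) {v : ℤ × ℤ} (hv : v ∈ shadow R)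
    (hJ : {cell v 0, cell v 1} ∉ t.dimers) :
    ∃ t' : Tiling R, Relation.ReflTransGen Move t t' ∧ jewels t < jewels t' := by
  obtain ⟨w, hw, hw0⟩ := (hR.jewel_or_horizontal t hv).resolve_left hJ 0 (by simp)
  by_cases hc : Crossed t v w
  swap
  · obtain ⟨t', hm, hj⟩ := exists_more_jewels_of_trivial t hw hw0 ((not_not.mp hc).mp hw0)
    exact ⟨t', Relation.ReflTransGen.single hm, hj⟩
  obtain ⟨h, B, hB, hh⟩ := exists_tiling_height hR t
  obtain ⟨f, g, hfg⟩ := hw.exists_between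
  have hne : ∃ u, h u ≠ 0 := by
    by_contra! h0
    exact (hh f g v w hfg).mp (by rw [h0, h0]) hc
  obtain ⟨Q, hQn, hQ, hQh⟩ := exists_innermost h B hB hne
  exact exists_more_jewels_of_closed hR _ t Q rfl hQn hQ fun f hf g v w hb =>
    (hQh f hf g hb.1).trans (hh f g v w hb)

/-- Every tiling of a duplex region is connected to the tiling by vertical dimers. -/
theorem exists_all_vertical (hR : IsDuplex R) (t : Tiling R) :
    ∃ t' : Tiling R, Relation.ReflTransGen Move t t' ∧
      ∀ v ∈ shadow R, {cell v 0, cell v 1} ∈ t'.dimers := by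
  classical
  -- A crude bound, enough for termination: dimers are subsets of `R`.
  have hbound : ∀ s : Tiling R, jewels s ≤ R.powerset.card := fun s =>
    Finset.card_le_card fun d hd =>
      Finset.mem_powerset.mpr (s.subset (Finset.mem_filter.mp hd).1)
  induction hn : R.powerset.card - jewels t using Nat.strong_induction_on generalizing t with
  | _ n ih =>
    by_cases hall : ∀ v ∈ shadow R, {cell v 0, cell v 1} ∈ t.dimers
    · exact ⟨t, Relation.ReflTransGen.refl, hall⟩
    · push Not at hall
      obtain ⟨v, hv, hJ⟩ := hall
      obtain ⟨t₁, h1, hlt⟩ := exists_more_jewels hR t hv hJ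
      have := hbound t₁
      obtain ⟨t₂, h2, hall⟩ := ih _ (by omega) t₁ rfl
      exact ⟨t₂, h1.trans h2, hall⟩

/-- The vertical dimers already cover every cell, so a tiling containing them all has no others. -/
theorem all_vertical_subset (hR : IsDuplex R) (s t : Tiling R)
    (hs : ∀ v ∈ shadow R, {cell v 0, cell v 1} ∈ s.dimers)
    (ht : ∀ v ∈ shadow R, {cell v 0, cell v 1} ∈ t.dimers) : s.dimers ⊆ t.dimers := by
  intro d hd
  obtain ⟨i, c, rfl⟩ := s.isDimer d hd
  have hc : cell (c 0, c 1) (c 2) ∈ R := by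
    rw [cell_eta]
    exact s.cell_mem hd
  obtain ⟨hv, hz⟩ := hR.cell_mem_iff.mp hc
  have : c ∈ ({cell (c 0, c 1) 0, cell (c 0, c 1) 1} : Finset Cell) := by
    rw [Finset.mem_insert, Finset.mem_singleton]
    rcases hz with hz | hz
    · left; rw [← hz, cell_eta]
    · right; rw [← hz, cell_eta]
  rw [s.eq_of_mem hd (hs _ hv) (Finset.mem_insert_self _ _) this]
  exact ht _ hv

end DominoBrick

/-- Any two tilings of a duplex region are joined by a finite sequence of flips and trits. -/
theorem mainTheorem2 (R : Finset DominoBrick.Cell) (hR : DominoBrick.IsDuplex R)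
    (t₀ t₁ : DominoBrick.Tiling R) :
    Relation.ReflTransGen
      (fun s t : DominoBrick.Tiling R => DominoBrick.IsFlip s t ∨ DominoBrick.IsTrit s t)
      t₀ t₁ := by
  obtain ⟨s₀, h0, hs0⟩ := DominoBrick.exists_all_vertical hR t₀
  obtain ⟨s₁, h1, hs1⟩ := DominoBrick.exists_all_vertical hR t₁
  have hs : s₀ = s₁ := DominoBrick.Tiling.ext <| Finset.Subset.antisymm
    (DominoBrick.all_vertical_subset hR s₀ s₁ hs0 hs1)
    (DominoBrick.all_vertical_subset hR s₁ s₀ hs1 hs0)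
  have : Std.Symm (DominoBrick.Move (R := R)) := ⟨fun _ _ h => ⟨h.2, h.1⟩⟩
  have h : Relation.ReflTransGen DominoBrick.Move t₀ t₁ :=
    h0.trans (hs ▸ Std.Symm.symm _ _ h1)
  exact Relation.ReflTransGen.mono (fun _ _ h => h.1) _ _ h
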